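/- Let $d\ge 1$, $T>0$, and let $\beta=\frac{1}{2d+4}\in(0,\tfrac12)$. For a Borel probability measure $\mu$ on $\mathbb R^d$ write $M_2(\mu)=\int |x|^2\,d\mu(x)$, let $\mathcal P_2(\mathbb R^d)$ be the set of those $\mu$ with $M_2(\mu)<\infty$, with the Wasserstein distance $\mathbf d_2$, where $\mathbf d_p(\mu,\nu)^p=\inf_\pi\int |x-y|^p\,d\pi(x,y)$, the infimum being over all couplings $\pi$ of $\mu$ and $\nu$. For ${\bf x}=(x^1,\dots,x^N)\in(\mathbb R^d)^N$ write $m^N_{\bf x}=\frac1N\sum_{k=1}^N\delta_{x^k}$. Let $\alpha\in\mathbb R^d$, $N\ge 1$, and $y^1_0,\dots,y^N_0\in\mathbb R^d$ (deterministic). Let $B^1,\dots,B^N$ be independent standard $d$-dimensional Brownian motions on a probability space $(\Omega,\mathcal F,\mathbb P)$, and put $$Y^k_t=y^k_0+\alpha t+\sqrt2\,B^k_t\qquad(1\le k\le N,\ t\ge 0),$$ so that ${\bf Y}_0=(y^1_0,\dots,y^N_0)$. Let $m\in C([0,T],\mathcal P_2(\mathbb R^d))$ be the solution, in the sense of distributions,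 of $$\partial_t m+\alpha\cdot Dm-\Delta m=0,\qquad m(0)=m^N_{{\bf Y}_0}.$$ Then there is a constant $C>0$, depending only on $d$, $T$ and $|\alpha|$ (in particular not on $N$, the initial points, the probability space or $h$), such that for all $h\in[0,T]$ $$\mathbb E\big[\mathbf d_1(m(h),m^N_{{\bf Y}_h})\big]\le C\,\big(1+M_2^{1/2}(m^N_{{\bf Y}_0})\big)\Big(\frac hN\Big)^{\beta}.$$ -/

import Mathlib

open MeasureTheory ProbabilityTheory Filter Topology Set
open scoped ENNReal NNReal Laplacian

noncomputable section

/-- The moment `M_p(μ) = ∫ |x|^p dμ(x)`, as an extended nonnegative number. -/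
def pMoment {d : ℕ} (p : ℝ) (μ : Measure (EuclideanSpace ℝ (Fin d))) : ℝ≥0∞ :=
  ∫⁻ x, ‖x‖ₑ ^ p ∂μ

/-- `π` is a coupling of `μ` and `ν`: its first and second marginals are `μ` and `ν`. -/
def IsCouplingOf {d : ℕ} (μ ν : Measure (EuclideanSpace ℝ (Fin d)))
    (π : Measure (EuclideanSpace ℝ (Fin d) × EuclideanSpace ℝ (Fin d))) : Prop :=
  π.map Prod.fst = μ ∧ π.map Prod.snd = ν

/-- The Wasserstein distance `d_p`, given by
`d_p(μ, ν)^p = inf_π ∫ |x - y|^p dπ(x, y)`, the infimum being over the couplings `π` of `μ` and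
`ν` (if `μ` and `ν` are probability measures, then so is every coupling of them). -/
def wassersteinDist {d : ℕ} (p : ℝ) (μ ν : Measure (EuclideanSpace ℝ (Fin d))) : ℝ≥0∞ :=
  (⨅ (π : Measure (EuclideanSpace ℝ (Fin d) × EuclideanSpace ℝ (Fin d)))
    (_ : IsCouplingOf μ ν π), ∫⁻ z, edist z.1 z.2 ^ p ∂π) ^ (1 / p)

/-- The empirical measure `(1 / N) ∑ₖ δ_{x k}` of `N` points. -/
def empiricalMeasure {d N : ℕ} (x : Fin N → EuclideanSpace ℝ (Fin d)) :
    Measure (EuclideanSpace ℝ (Fin d)) :=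
  (N : ℝ≥0∞)⁻¹ • ∑ k, Measure.dirac (x k)

/-- A standard `d`-dimensional Brownian motion: its coordinates are independent standard
real Brownian motions (started at `0`). -/
structure IsStdBrownianMotion {d : ℕ} {Ω : Type*} [MeasurableSpace Ω]
    (B : ℝ≥0 → Ω → EuclideanSpace ℝ (Fin d)) (P : Measure Ω) : Prop where
  coord : ∀ i, IsBrownianReal (fun t ω => B t ω i) P
  indep : iIndepFun (fun (i : Fin d) ω (t : ℝ≥0) => B t ω i) P

/-- `m ∈ C([0,T], 𝒫₂(ℝᵈ))` solves `∂ₜ m + α · D m - Δ m = 0`, `m(0) = μ₀`, in the sense of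
distributions. The equation is tested against `φ ∈ C_c^∞(ℝᵈ)` and integrated in time, which for
continuous curves of measures is the usual weak formulation; `fderiv ℝ φ x α` is `α · Dφ(x)`.
Only the values of `m` on `[0,T]` matter. -/
structure IsDriftedHeatSolution {d : ℕ} (α : EuclideanSpace ℝ (Fin d)) (T : ℝ)
    (μ₀ : Measure (EuclideanSpace ℝ (Fin d))) (m : ℝ → Measure (EuclideanSpace ℝ (Fin d))) :
    Prop where
  isProbabilityMeasure : ∀ t ∈ Icc 0 T, IsProbabilityMeasure (m t)
  moment_lt_top : ∀ t ∈ Icc 0 T, pMoment 2 (m t) < ∞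
  continuous : ∀ t ∈ Icc 0 T,
    Tendsto (fun s => wassersteinDist 2 (m s) (m t)) (𝓝[Icc 0 T] t) (𝓝 0)
  initial : m 0 = μ₀
  equation : ∀ φ : EuclideanSpace ℝ (Fin d) → ℝ, ContDiff ℝ (⊤ : ℕ∞) φ → HasCompactSupport φ →
    ∀ t ∈ Icc 0 T,
      ∫ x, φ x ∂(m t) = ∫ x, φ x ∂(m 0)
        + ∫ s in (0 : ℝ)..t, ∫ x, (fderiv ℝ φ x α + (Δ φ) x) ∂(m s)

end

/-! Testing the equation against plane waves gives a linear ODE for each Fourier mode of `m`, so `m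
h` must be the average of the laws of the particles at time `h`
(`IsDriftedHeatSolution.eq_average_map`). What remains is to compare an empirical measure of
independent, not identically distributed Gaussian points with its mean; the drift merely translates
both.

For `n` points with moments of order `d + 3` bounded uniformly, both measures are averaged over
balls of radius `ε`, at cost `n ε` each. The resulting densities are compared by leaving their
common part in place and sending the excess through the origin. The count in a ball has standard
deviation at most the square root of its mean, so a weighted Cauchy-Schwarz inequality bounds this
part by a multiple of `n ^ (1/2) * ε ^ (-d/2)`. The choice `ε = n ^ (-1/(d+2))` gives a total cost
of order `n ^ θ`, with `θ = 1 - 1/(d+2)` (`exists_const_hasCouplingCost_sum_dirac`).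

The factor in `h` comes from clustering. Starting points in one cube of side `√h` give, after
recentring and division by `√h`, a sample with moments independent of `h`, so a cluster of `n`
points costs a multiple of `√h * n ^ θ`. With `M` equal to one plus the root mean square of the
starting points, cubes are used inside radius `R = M * N ^ β`, and each point outside is its own
cluster. Hölder's inequality over the cubes (`exists_labelling`), Chebyshev's inequality for the
outliers and the balance of exponents in `rate_balance` yield the rate. -/

/-! ### Calculus of couplings with bounded cost -/

/-- Two measures admit a coupling whose transport cost `∫ |x - y| dπ` is at most `K`. -/
def HasCouplingCost {d : ℕ} (μ ν : Measure (EuclideanSpace ℝ (Fin d))) (K : ℝ≥0∞) : Prop :=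
  ∃ π, IsCouplingOf μ ν π ∧ ∫⁻ z, edist z.1 z.2 ∂π ≤ K

namespace HasCouplingCost

variable {d : ℕ} {μ ν ρ : Measure (EuclideanSpace ℝ (Fin d))} {K L : ℝ≥0∞}

theorem wassersteinDist_le (h : HasCouplingCost μ ν K) : wassersteinDist 1 μ ν ≤ K := by
  obtain ⟨π, hπ, hK⟩ := h
  simp only [wassersteinDist, ENNReal.rpow_one, div_one]
  exact (iInf₂_le π hπ).trans hK

theorem mono (h : HasCouplingCost μ ν K) (hKL : K ≤ L) : HasCouplingCost μ ν L := by
  obtain ⟨π, hπ, hK⟩ := h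
  exact ⟨π, hπ, hK.trans hKL⟩

theorem refl (μ : Measure (EuclideanSpace ℝ (Fin d))) : HasCouplingCost μ μ 0 := by
  refine ⟨μ.map fun x => (x, x), ⟨?_, ?_⟩, ?_⟩
  · rw [Measure.map_map measurable_fst (by fun_prop)]; exact Measure.map_id
  · rw [Measure.map_map measurable_snd (by fun_prop)]; exact Measure.map_id
  · rw [lintegral_map (by fun_prop) (by fun_prop)]; simp

theorem symm (h : HasCouplingCost μ ν K) : HasCouplingCost ν μ K := by
  obtain ⟨π, ⟨h1, h2⟩, hK⟩ := h
  refine ⟨π.map Prod.swap, ⟨?_, ?_⟩, ?_⟩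
  · rw [Measure.map_map measurable_fst measurable_swap]; exact h2
  · rw [Measure.map_map measurable_snd measurable_swap]; exact h1
  · rw [lintegral_map (by fun_prop) measurable_swap]
    simpa [edist_comm] using hK

/-- Gluing: both couplings are disintegrated over the common marginal `ν`, and the two outer points
are drawn conditionally independently given the middle one. -/
theorem trans [IsFiniteMeasure ν] (h : HasCouplingCost μ ν K) (h' : HasCouplingCost ν ρ L) :
    HasCouplingCost μ ρ (K + L) := by
  -- Symmetry makes `ν` the first marginal of both couplings, the one over which `condKernel`
  -- disintegrates.
  obtain ⟨π₁, ⟨h1, h2⟩, hK⟩ := h.symm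
  obtain ⟨π₂, ⟨h3, h4⟩, hL⟩ := h'
  have : IsFiniteMeasure π₁ := ⟨by
    rw [← preimage_univ (f := Prod.fst), ← Measure.map_apply measurable_fst .univ, h1]
    exact measure_lt_top _ _⟩
  have : IsFiniteMeasure π₂ := ⟨by
    rw [← preimage_univ (f := Prod.fst), ← Measure.map_apply measurable_fst .univ, h3]
    exact measure_lt_top _ _⟩
  set G := ν ⊗ₘ (π₁.condKernel ×ₖ π₂.condKernel) with hG
  have hG1 : G.map (Prod.map id Prod.fst) = π₁ := by
    rw [hG, ← Measure.compProd_map measurable_fst, ← Kernel.fst_eq, Kernel.fst_prod, ← h1]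
    exact π₁.disintegrate π₁.condKernel
  have hG2 : G.map (Prod.map id Prod.snd) = π₂ := by
    rw [hG, ← Measure.compProd_map measurable_snd, ← Kernel.snd_eq, Kernel.snd_prod, ← h3]
    exact π₂.disintegrate π₂.condKernel
  refine ⟨G.map Prod.snd, ⟨?_, ?_⟩, ?_⟩
  · rw [Measure.map_map measurable_fst measurable_snd, ← h2, ← hG1,
      Measure.map_map measurable_snd (by fun_prop)]
    rfl
  · rw [Measure.map_map measurable_snd measurable_snd, ← h4, ← hG2,
      Measure.map_map measurable_snd (by fun_prop)]
    rfl
  · rw [lintegral_map (by fun_prop) measurable_snd]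
    calc ∫⁻ p, edist p.2.1 p.2.2 ∂G ≤ ∫⁻ p, (edist p.1 p.2.1 + edist p.1 p.2.2) ∂G :=
          lintegral_mono fun p => by
            rw [edist_comm p.1 p.2.1]; exact edist_triangle _ _ _
      _ = ∫⁻ p, edist p.1 p.2.1 ∂G + ∫⁻ p, edist p.1 p.2.2 ∂G :=
          lintegral_add_left (by fun_prop) _
      _ = ∫⁻ z, edist z.1 z.2 ∂π₁ + ∫⁻ z, edist z.1 z.2 ∂π₂ := by
          conv_rhs => rw [← hG1, ← hG2]
          rw [lintegral_map (by fun_prop) (by fun_prop), lintegral_map (by fun_prop) (by fun_prop)]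
          rfl
      _ ≤ K + L := add_le_add hK hL

theorem add {μ' ν' : Measure (EuclideanSpace ℝ (Fin d))} (h : HasCouplingCost μ ν K)
    (h' : HasCouplingCost μ' ν' L) : HasCouplingCost (μ + μ') (ν + ν') (K + L) := by
  obtain ⟨π₁, ⟨h1, h2⟩, hK⟩ := h
  obtain ⟨π₂, ⟨h3, h4⟩, hL⟩ := h'
  refine ⟨π₁ + π₂, ⟨?_, ?_⟩, ?_⟩
  · rw [Measure.map_add _ _ measurable_fst, h1, h3]
  · rw [Measure.map_add _ _ measurable_snd, h2, h4]
  · rw [lintegral_add_measure]; exact add_le_add hK hL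

theorem sum {ι : Type*} (s : Finset ι) {μ ν : ι → Measure (EuclideanSpace ℝ (Fin d))}
    {K : ι → ℝ≥0∞} (h : ∀ i ∈ s, HasCouplingCost (μ i) (ν i) (K i)) :
    HasCouplingCost (∑ i ∈ s, μ i) (∑ i ∈ s, ν i) (∑ i ∈ s, K i) := by
  classical
  induction s using Finset.induction_on with
  | empty => simpa using refl _
  | insert i s hi ih =>
    simp only [Finset.sum_insert hi]
    exact (h i (Finset.mem_insert_self i s)).add
      (ih fun j hj => h j (Finset.mem_insert_of_mem hj))

theorem smul (h : HasCouplingCost μ ν K) (c : ℝ≥0∞) :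
    HasCouplingCost (c • μ) (c • ν) (c * K) := by
  obtain ⟨π, ⟨h1, h2⟩, hK⟩ := h
  refine ⟨c • π, ⟨?_, ?_⟩, ?_⟩
  · rw [Measure.map_smul, h1]
  · rw [Measure.map_smul, h2]
  · rw [lintegral_smul_measure, smul_eq_mul]; gcongr

theorem map_lipschitz (h : HasCouplingCost μ ν K) {c : ℝ≥0}
    {f : EuclideanSpace ℝ (Fin d) → EuclideanSpace ℝ (Fin d)} (hf : LipschitzWith c f) :
    HasCouplingCost (μ.map f) (ν.map f) (c * K) := by
  obtain ⟨π, ⟨h1, h2⟩, hK⟩ := h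
  have hm : Measurable f := hf.continuous.measurable
  refine ⟨π.map (Prod.map f f), ⟨?_, ?_⟩, ?_⟩
  · rw [Measure.map_map measurable_fst (by fun_prop), ← h1,
      Measure.map_map hm measurable_fst]; rfl
  · rw [Measure.map_map measurable_snd (by fun_prop), ← h2,
      Measure.map_map hm measurable_snd]; rfl
  · rw [lintegral_map (by fun_prop) (by fun_prop)]
    calc ∫⁻ p, edist (f p.1) (f p.2) ∂π ≤ ∫⁻ p, c * edist p.1 p.2 ∂π :=
          lintegral_mono fun p => hf p.1 p.2
      _ = c * ∫⁻ p, edist p.1 p.2 ∂π := lintegral_const_mul _ (by fun_prop)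
      _ ≤ c * K := by gcongr

/-- Keep the common part of two measures in place and transport the rest through the origin. -/
theorem of_common_part {r a b : Measure (EuclideanSpace ℝ (Fin d))} [IsFiniteMeasure a]
    (hab : a univ = b univ) :
    HasCouplingCost (r + a) (r + b) (∫⁻ x, ‖x‖ₑ ∂a + ∫⁻ x, ‖x‖ₑ ∂b) := by
  have : IsFiniteMeasure b := ⟨hab ▸ measure_lt_top a univ⟩
  suffices h : HasCouplingCost a b (∫⁻ x, ‖x‖ₑ ∂a + ∫⁻ x, ‖x‖ₑ ∂b) by
    simpa using (refl r).add h
  by_cases h0 : a univ = 0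
  · have ha : a = 0 := Measure.measure_univ_eq_zero.1 h0
    have hb : b = 0 := Measure.measure_univ_eq_zero.1 (hab ▸ h0)
    subst ha hb
    simpa using refl (0 : Measure (EuclideanSpace ℝ (Fin d)))
  have hinv : (a univ)⁻¹ * a univ = 1 := ENNReal.inv_mul_cancel h0 (measure_ne_top _ _)
  refine ⟨(a univ)⁻¹ • a.prod b, ⟨?_, ?_⟩, ?_⟩
  · rw [Measure.map_smul, Measure.map_fst_prod, ← hab, smul_smul, hinv, one_smul]
  · rw [Measure.map_smul, Measure.map_snd_prod, smul_smul, hinv, one_smul]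
  · rw [lintegral_smul_measure, smul_eq_mul]
    have key : ∫⁻ z, edist z.1 z.2 ∂(a.prod b)
        ≤ a univ * (∫⁻ x, ‖x‖ₑ ∂a + ∫⁻ x, ‖x‖ₑ ∂b) := by
      calc ∫⁻ z, edist z.1 z.2 ∂(a.prod b) ≤ ∫⁻ z, (‖z.1‖ₑ + ‖z.2‖ₑ) ∂(a.prod b) :=
            lintegral_mono fun z => by
              rw [edist_eq_enorm_sub]; exact enorm_sub_le
        _ = ∫⁻ z, ‖z.1‖ₑ ∂(a.prod b) + ∫⁻ z, ‖z.2‖ₑ ∂(a.prod b) :=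
            lintegral_add_left (by fun_prop) _
        _ = a univ * (∫⁻ x, ‖x‖ₑ ∂a + ∫⁻ x, ‖x‖ₑ ∂b) := by
            rw [lintegral_prod _ (by fun_prop), lintegral_prod _ (by fun_prop)]
            simp only [lintegral_const]
            rw [lintegral_mul_const _ (by fun_prop), ← hab]
            ring
    calc (a univ)⁻¹ * ∫⁻ z, edist z.1 z.2 ∂(a.prod b)
        ≤ (a univ)⁻¹ * (a univ * (∫⁻ x, ‖x‖ₑ ∂a + ∫⁻ x, ‖x‖ₑ ∂b)) := by gcongr
      _ = _ := by rw [← mul_assoc, hinv, one_mul]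

/-- The pointwise minimum of the densities is the common part that stays in place; only the two
truncated differences move. -/
theorem withDensity {f g : EuclideanSpace ℝ (Fin d) → ℝ≥0∞}
    {vol : Measure (EuclideanSpace ℝ (Fin d))} (hf : Measurable f) (hg : Measurable g)
    (hfin : ∫⁻ x, f x ∂vol ≠ ∞) (hfg : ∫⁻ x, f x ∂vol = ∫⁻ x, g x ∂vol) :
    HasCouplingCost (vol.withDensity f) (vol.withDensity g)
      (∫⁻ x, ‖x‖ₑ * ((f x - g x) + (g x - f x)) ∂vol) := by
  have h1 : vol.withDensity f
      = vol.withDensity (fun x => min (f x) (g x)) + vol.withDensity (fun x => f x - g x) := by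
    rw [← withDensity_add_left (by fun_prop)]
    congr 1; ext x
    simp [add_comm, tsub_add_min]
  have h2 : vol.withDensity g
      = vol.withDensity (fun x => min (f x) (g x)) + vol.withDensity (fun x => g x - f x) := by
    rw [← withDensity_add_left (by fun_prop)]
    congr 1; ext x
    simp only [Pi.add_apply]
    rw [add_comm, min_comm, tsub_add_min]
  have hfinite : IsFiniteMeasure (vol.withDensity (fun x => f x - g x)) := by
    refine isFiniteMeasure_withDensity (ne_top_of_le_ne_top hfin ?_)
    exact lintegral_mono fun x => tsub_le_self
  -- The excesses have equal mass because the total masses agree and the finite common mass cancels.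
  have hmass : vol.withDensity (fun x => f x - g x) univ
      = vol.withDensity (fun x => g x - f x) univ := by
    have hr : vol.withDensity (fun x => min (f x) (g x)) univ ≠ ∞ := by
      rw [withDensity_apply _ .univ, setLIntegral_univ]
      exact ne_top_of_le_ne_top hfin (lintegral_mono fun x => min_le_left _ _)
    refine (ENNReal.add_right_inj hr).1 ?_
    rw [← Measure.add_apply, ← Measure.add_apply, ← h1, ← h2, withDensity_apply _ .univ,
      withDensity_apply _ .univ, setLIntegral_univ, setLIntegral_univ, hfg]
  rw [h1, h2]
  refine (of_common_part hmass).mono (le_of_eq ?_)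
  rw [lintegral_withDensity_eq_lintegral_mul _ (by fun_prop) (by fun_prop),
    lintegral_withDensity_eq_lintegral_mul _ (by fun_prop) (by fun_prop),
    ← lintegral_add_left (by fun_prop)]
  refine lintegral_congr fun x => ?_
  simp only [Pi.mul_apply]
  ring

/-- A point distributed by `μ` is paired with a uniform point of the ball of radius `ε` around it:
the coupling is `μ.prod volume` restricted to pairs at distance less than `ε`, divided by the volume
of the ball. -/
theorem smoothing (μ : Measure (EuclideanSpace ℝ (Fin d))) [IsFiniteMeasure μ] {ε : ℝ}
    (hε : 0 < ε) :
    HasCouplingCost μ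
      (volume.withDensity fun x =>
        (volume (Metric.ball (0 : EuclideanSpace ℝ (Fin d)) ε))⁻¹ * μ (Metric.ball x ε))
      (ENNReal.ofReal ε * μ univ) := by
  set V := volume (Metric.ball (0 : EuclideanSpace ℝ (Fin d)) ε) with hV
  have hV0 : V ≠ 0 := (Metric.measure_ball_pos _ _ hε).ne'
  have hVt : V ≠ ∞ := measure_ball_lt_top.ne
  have hinv : V⁻¹ * V = 1 := ENNReal.inv_mul_cancel hV0 hVt
  have hball : ∀ x : EuclideanSpace ℝ (Fin d), volume (Metric.ball x ε) = V := fun x => by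
    rw [hV, Measure.addHaar_ball_center]
  set S : Set (EuclideanSpace ℝ (Fin d) × EuclideanSpace ℝ (Fin d)) := {p | dist p.1 p.2 < ε}
    with hS
  have hSm : MeasurableSet S := measurableSet_lt (by fun_prop) (by fun_prop)
  have hfst : (V⁻¹ • (μ.prod volume).restrict S).map Prod.fst = μ := by
    ext A hA
    rw [Measure.map_apply measurable_fst hA, Measure.smul_apply, smul_eq_mul,
      Measure.restrict_apply (measurable_fst hA),
      Measure.prod_apply ((measurable_fst hA).inter hSm)]
    have : ∀ x, volume (Prod.mk x ⁻¹' (Prod.fst ⁻¹' A ∩ S)) = A.indicator (fun _ => V) x := by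
      intro x
      by_cases hx : x ∈ A
      · rw [indicator_of_mem hx, ← hball x]
        congr 1; ext y
        simp [hS, hx, dist_comm]
      · rw [indicator_of_notMem hx]
        convert measure_empty (μ := (volume : Measure (EuclideanSpace ℝ (Fin d))))
        ext y; simp [hx]
    simp_rw [this]
    rw [lintegral_indicator_const hA, ← mul_assoc, hinv, one_mul]
  have hsnd : (V⁻¹ • (μ.prod volume).restrict S).map Prod.snd
      = volume.withDensity fun x => V⁻¹ * μ (Metric.ball x ε) := by
    ext A hA
    rw [Measure.map_apply measurable_snd hA, Measure.smul_apply, smul_eq_mul,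
      Measure.restrict_apply (measurable_snd hA),
      Measure.prod_apply_symm ((measurable_snd hA).inter hSm), withDensity_apply _ hA,
      lintegral_const_mul' _ _ (ENNReal.inv_ne_top.2 hV0), ← lintegral_indicator hA]
    congr 1
    refine lintegral_congr fun y => ?_
    by_cases hy : y ∈ A
    · rw [indicator_of_mem hy]
      congr 1; ext x
      simp [hS, hy]
    · rw [indicator_of_notMem hy]
      convert measure_empty (μ := μ)
      ext x; simp [hy]
  refine ⟨V⁻¹ • (μ.prod volume).restrict S, ⟨hfst, hsnd⟩, ?_⟩
  have huniv : (V⁻¹ • (μ.prod volume).restrict S) univ = μ univ := by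
    conv_rhs => rw [← hfst]
    rw [Measure.map_apply measurable_fst .univ, preimage_univ]
  rw [← huniv, ← lintegral_const]
  refine lintegral_mono_ae (Measure.ae_smul_measure ?_ _)
  filter_upwards [ae_restrict_mem hSm] with p hp
  rw [edist_dist]
  exact ENNReal.ofReal_le_ofReal (le_of_lt hp)

end HasCouplingCost

/-! ### Comparison of measures through masses of balls -/

theorem measurable_measure_ball {d : ℕ} (μ : Measure (EuclideanSpace ℝ (Fin d))) [SFinite μ]
    (ε : ℝ) : Measurable fun x => μ (Metric.ball x ε) := by
  have hSm : MeasurableSet {p : EuclideanSpace ℝ (Fin d) × EuclideanSpace ℝ (Fin d) |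
      dist p.2 p.1 < ε} := measurableSet_lt (by fun_prop) (by fun_prop)
  exact measurable_measure_prodMk_left hSm

/-- Comparison of two measures of equal mass through their values on the balls of radius `ε`. -/
theorem hasCouplingCost_of_ball {d : ℕ} (μ ν : Measure (EuclideanSpace ℝ (Fin d)))
    [IsFiniteMeasure μ] [IsFiniteMeasure ν] (hμν : μ univ = ν univ) {ε : ℝ} (hε : 0 < ε) :
    HasCouplingCost μ ν (2 * ENNReal.ofReal ε * μ univ
      + (volume (Metric.ball (0 : EuclideanSpace ℝ (Fin d)) ε))⁻¹
        * ∫⁻ x, ‖x‖ₑ * ((μ (Metric.ball x ε) - ν (Metric.ball x ε))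
          + (ν (Metric.ball x ε) - μ (Metric.ball x ε)))) := by
  have h1 := HasCouplingCost.smoothing μ hε
  have h2 := HasCouplingCost.smoothing ν hε
  set V := volume (Metric.ball (0 : EuclideanSpace ℝ (Fin d)) ε) with hV
  have hV0 : V ≠ 0 := (Metric.measure_ball_pos _ _ hε).ne'
  have hVt : V⁻¹ ≠ ∞ := ENNReal.inv_ne_top.2 hV0
  -- The smoothing coupling already shows that averaging preserves mass, since its two marginals
  -- have the same total mass.
  have mass : ∀ (ρ : Measure (EuclideanSpace ℝ (Fin d))) (K : ℝ≥0∞),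
      HasCouplingCost ρ (volume.withDensity fun x => V⁻¹ * ρ (Metric.ball x ε)) K →
      ∫⁻ x, V⁻¹ * ρ (Metric.ball x ε) = ρ univ := by
    rintro ρ K ⟨π, ⟨hπ1, hπ2⟩, -⟩
    rw [← setLIntegral_univ, ← withDensity_apply _ .univ, ← hπ2,
      Measure.map_apply measurable_snd .univ, preimage_univ, ← preimage_univ (f := Prod.fst),
      ← Measure.map_apply measurable_fst .univ, hπ1]
  have m1 := mass μ _ h1
  have m2 := mass ν _ h2
  have hmμ := measurable_measure_ball μ ε
  have hmν := measurable_measure_ball ν ε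
  have hd := HasCouplingCost.withDensity (vol := volume)
    (f := fun x => V⁻¹ * μ (Metric.ball x ε)) (g := fun x => V⁻¹ * ν (Metric.ball x ε))
    (hmμ.const_mul _) (hmν.const_mul _) (by rw [m1]; exact measure_ne_top _ _)
    (by rw [m1, m2, hμν])
  have : IsFiniteMeasure (volume.withDensity fun x => V⁻¹ * μ (Metric.ball x ε)) :=
    isFiniteMeasure_withDensity (by rw [m1]; exact measure_ne_top _ _)
  have : IsFiniteMeasure (volume.withDensity fun x => V⁻¹ * ν (Metric.ball x ε)) :=
    isFiniteMeasure_withDensity (by rw [m2]; exact measure_ne_top _ _)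
  refine ((h1.trans hd).trans h2.symm).mono (le_of_eq ?_)
  rw [← lintegral_const_mul' _ _ hVt, ← hμν, two_mul, add_mul, add_assoc, add_assoc]
  congr 1
  rw [add_comm]
  congr 1
  refine lintegral_congr fun x => ?_
  rw [← ENNReal.mul_sub fun _ _ => hVt, ← ENNReal.mul_sub fun _ _ => hVt]
  ring

theorem ENNReal.sub_add_sub_eq_enorm {a b : ℝ≥0∞} (ha : a ≠ ∞) (hb : b ≠ ∞) :
    (a - b) + (b - a) = ‖b.toReal - a.toReal‖ₑ := by
  rcases le_total a b with h | h
  · rw [tsub_eq_zero_of_le h, zero_add, ← ENNReal.toReal_sub_of_le h hb, Real.enorm_eq_ofReal (by positivity),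
      ENNReal.ofReal_toReal (ENNReal.sub_ne_top hb)]
  · rw [tsub_eq_zero_of_le h, add_zero, ← neg_sub, enorm_neg, ← ENNReal.toReal_sub_of_le h ha,
      Real.enorm_eq_ofReal (by positivity), ENNReal.ofReal_toReal (ENNReal.sub_ne_top ha)]

/-! ### Fluctuations of sums of independent Dirac masses -/

section Fluctuation

variable {d : ℕ} {Ω ι : Type*} [MeasurableSpace Ω] {P : Measure Ω} [IsProbabilityMeasure P]
  {X : ι → Ω → EuclideanSpace ℝ (Fin d)}

/-- The number of points in `A` is a sum of independent Bernoulli variables, so its variance is at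
most its mean; the `L¹` deviation is bounded by the `L²` deviation. The laws need not be identical.
-/
theorem lintegral_sum_dirac_fluctuation_le (hX : ∀ k, Measurable (X k)) (hind : iIndepFun X P)
    (S : Finset ι) {A : Set (EuclideanSpace ℝ (Fin d))} (hA : MeasurableSet A) :
    ∫⁻ ω, (((∑ k ∈ S, P.map (X k)) A - (∑ k ∈ S, Measure.dirac (X k ω)) A)
        + ((∑ k ∈ S, Measure.dirac (X k ω)) A - (∑ k ∈ S, P.map (X k)) A)) ∂P
      ≤ ((∑ k ∈ S, P.map (X k)) A) ^ (1 / 2 : ℝ) := by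
  set Z : ι → Ω → ℝ := fun k => (A.indicator fun _ => (1 : ℝ)) ∘ X k with hZ
  have hZm : ∀ k, Measurable (Z k) := fun k =>
    (measurable_const.indicator hA).comp (hX k)
  have hZ01 : ∀ k ω, Z k ω = 0 ∨ Z k ω = 1 := fun k ω => by
    by_cases h : X k ω ∈ A <;> simp [hZ, h]
  have hZL : ∀ k, MemLp (Z k) 2 P := fun k =>
    MemLp.of_bound (hZm k).aestronglyMeasurable 1 (Eventually.of_forall fun ω => by
      rcases hZ01 k ω with h | h <;> simp [h])
  have hfin : (∑ k ∈ S, P.map (X k)) A ≠ ∞ := by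
    rw [Measure.finsetSum_apply]
    refine ENNReal.sum_ne_top.2 fun k _ => ?_
    rw [Measure.map_apply (hX k) hA]
    exact measure_ne_top _ _
  have hEZ : ∀ k, ∫ ω, Z k ω ∂P = P.real (X k ⁻¹' A) := fun k => by
    have : Z k = (X k ⁻¹' A).indicator fun _ => (1 : ℝ) := by
      ext ω; simp only [hZ, Function.comp_apply, indicator]; rfl
    rw [this, integral_indicator_const _ (hX k hA)]; simp
  set W : Ω → ℝ := fun ω => ∑ k ∈ S, Z k ω with hW
  have hWL : MemLp W 2 P := memLp_finsetSum _ fun k _ => hZL k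
  have hEW : ∫ ω, W ω ∂P = ((∑ k ∈ S, P.map (X k)) A).toReal := by
    rw [hW, integral_finsetSum _ fun k _ => (hZL k).integrable (by norm_num),
      Measure.finsetSum_apply, ENNReal.toReal_sum]
    · refine Finset.sum_congr rfl fun k _ => ?_
      rw [hEZ, Measure.map_apply (hX k) hA]; rfl
    · intro k _
      rw [Measure.map_apply (hX k) hA]
      exact measure_ne_top _ _
  have hvar : variance W P ≤ ((∑ k ∈ S, P.map (X k)) A).toReal := by
    have h1 : variance W P = ∑ k ∈ S, variance (Z k) P := by
      have : W = ∑ k ∈ S, Z k := by ext ω; simp [hW]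
      rw [this]
      refine IndepFun.variance_sum (fun k _ => hZL k) fun i _ j _ hij => ?_
      exact (hind.indepFun hij).comp (measurable_const.indicator hA) (measurable_const.indicator hA)
    rw [h1, ← hEW, hW, integral_finsetSum _ fun k _ => (hZL k).integrable (by norm_num)]
    refine Finset.sum_le_sum fun k _ => ?_
    refine (variance_le_expectation_sq (hZm k).aestronglyMeasurable).trans (le_of_eq ?_)
    refine integral_congr_ae (Eventually.of_forall fun ω => ?_)
    -- An indicator equals its square, so the second moment is the mean.
    rcases hZ01 k ω with h | h <;> simp [h]
  have hpt : ∀ ω, (((∑ k ∈ S, P.map (X k)) A - (∑ k ∈ S, Measure.dirac (X k ω)) A)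
        + ((∑ k ∈ S, Measure.dirac (X k ω)) A - (∑ k ∈ S, P.map (X k)) A))
        = ‖W ω - ∫ ω, W ω ∂P‖ₑ := fun ω => by
    have hWω : W ω = ((∑ k ∈ S, Measure.dirac (X k ω)) A).toReal := by
      rw [Measure.finsetSum_apply, ENNReal.toReal_sum fun k _ => measure_ne_top _ _]
      refine Finset.sum_congr rfl fun k _ => ?_
      rw [Measure.dirac_apply' _ hA]
      by_cases h : X k ω ∈ A <;> simp [hZ, h]
    rw [ENNReal.sub_add_sub_eq_enorm hfin, hEW, hWω]
    rw [Measure.finsetSum_apply]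
    exact ENNReal.sum_ne_top.2 fun k _ => measure_ne_top _ _
  simp_rw [hpt]
  have hfm : AEStronglyMeasurable (fun ω => W ω - ∫ ω, W ω ∂P) P :=
    hWL.aestronglyMeasurable.sub aestronglyMeasurable_const
  have h12 := eLpNorm_le_eLpNorm_of_exponent_le (p := 1) (q := 2) (by norm_num) hfm
  rw [eLpNorm_one_eq_lintegral_enorm,
    eLpNorm_eq_lintegral_rpow_enorm_toReal (by norm_num) (by norm_num)] at h12
  refine h12.trans ?_
  simp only [ENNReal.toReal_ofNat]
  gcongr
  have h3 : ∫⁻ ω, ‖W ω - ∫ ω, W ω ∂P‖ₑ ^ (2 : ℝ) ∂P = evariance W P := by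
    simp [evariance]
  rw [h3, ← ofReal_variance hWL]
  exact ENNReal.ofReal_le_of_le_toReal hvar

/-- Tonelli's theorem moves the integral over centres inside; since `ε ≤ 1`, a centre `x` whose ball
contains `y` satisfies `‖x‖ ≤ ‖y‖ + 1`. -/
theorem lintegral_weight_mul_measure_ball_le (μ : Measure (EuclideanSpace ℝ (Fin d))) [SFinite μ]
    {ε : ℝ} (hε : ε ≤ 1) (s : ℕ) :
    ∫⁻ x, ENNReal.ofReal ((1 + ‖x‖) ^ s) * μ (Metric.ball x ε)
      ≤ volume (Metric.ball (0 : EuclideanSpace ℝ (Fin d)) ε)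
        * ∫⁻ y, ENNReal.ofReal ((2 + ‖y‖) ^ s) ∂μ := by
  have hSm : MeasurableSet {p : EuclideanSpace ℝ (Fin d) × EuclideanSpace ℝ (Fin d) |
      dist p.2 p.1 < ε} := measurableSet_lt (by fun_prop) (by fun_prop)
  set F : EuclideanSpace ℝ (Fin d) × EuclideanSpace ℝ (Fin d) → ℝ≥0∞ :=
    {p | dist p.2 p.1 < ε}.indicator fun p => ENNReal.ofReal ((1 + ‖p.1‖) ^ s) with hF
  have hFm : Measurable F := Measurable.indicator (by fun_prop) hSm
  have h1 : ∀ x, ENNReal.ofReal ((1 + ‖x‖) ^ s) * μ (Metric.ball x ε) = ∫⁻ y, F (x, y) ∂μ := by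
    intro x
    rw [← lintegral_indicator_const Metric.isOpen_ball.measurableSet]
    rfl
  simp_rw [h1]
  rw [lintegral_lintegral_swap (f := fun x y => F (x, y)) hFm.aemeasurable, ← lintegral_const_mul _ (by fun_prop)]
  refine lintegral_mono fun y => ?_
  calc ∫⁻ x, F (x, y) ≤ ∫⁻ x, (Metric.ball y ε).indicator
        (fun _ => ENNReal.ofReal ((2 + ‖y‖) ^ s)) x := by
        refine lintegral_mono fun x => ?_
        by_cases h : dist y x < ε
        · rw [hF, indicator_of_mem (by exact h), indicator_of_mem (by simpa [dist_comm] using h)]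
          refine ENNReal.ofReal_le_ofReal ?_
          have : ‖x‖ ≤ ‖y‖ + dist y x := by
            rw [dist_eq_norm]
            have := norm_sub_norm_le x y
            rw [norm_sub_rev] at this; linarith
          gcongr ?_ ^ s
          linarith
        · rw [hF, indicator_of_notMem (by exact h)]; exact bot_le
    _ = volume (Metric.ball (0 : EuclideanSpace ℝ (Fin d)) ε) * ENNReal.ofReal ((2 + ‖y‖) ^ s) := by
        rw [lintegral_indicator_const Metric.isOpen_ball.measurableSet,
          Measure.addHaar_ball_center, mul_comm]

theorem lintegral_rpow_half_mul_le {α : Type*} [MeasurableSpace α] (μ : Measure α)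
    {f g : α → ℝ≥0∞} (hf : AEMeasurable f μ) (hg : AEMeasurable g μ) :
    ∫⁻ x, f x ^ (1 / 2 : ℝ) * g x ^ (1 / 2 : ℝ) ∂μ
      ≤ (∫⁻ x, f x ∂μ) ^ (1 / 2 : ℝ) * (∫⁻ x, g x ∂μ) ^ (1 / 2 : ℝ) := by
  have := ENNReal.lintegral_mul_le_Lp_mul_Lq μ Real.HolderConjugate.two_two
    (hf.pow_const (1 / 2 : ℝ)) (hg.pow_const (1 / 2 : ℝ))
  simp only [← ENNReal.rpow_mul] at this
  norm_num at this
  simpa using this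

/-- Cauchy-Schwarz with the weight `(1 + ‖x‖) ^ (-(d + 1))`, integrable in dimension `d`. The
complementary weight has exponent `d + 3`, so that the product of the two is `(1 + ‖x‖) ^ 2`, whose
square root dominates `‖x‖`. -/
theorem lintegral_norm_mul_rpow_half_le (m : EuclideanSpace ℝ (Fin d) → ℝ≥0∞)
    (hm : Measurable m) :
    ∫⁻ x, ‖x‖ₑ * m x ^ (1 / 2 : ℝ)
      ≤ (∫⁻ x : EuclideanSpace ℝ (Fin d), ENNReal.ofReal ((1 + ‖x‖) ^ (-((d : ℝ) + 1))))
            ^ (1 / 2 : ℝ)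
        * (∫⁻ x, ENNReal.ofReal ((1 + ‖x‖) ^ (d + 3)) * m x) ^ (1 / 2 : ℝ) := by
  refine le_trans (lintegral_mono fun x => ?_)
    (lintegral_rpow_half_mul_le volume (by fun_prop) (by fun_prop))
  rw [ENNReal.mul_rpow_of_nonneg _ _ (by norm_num), ← mul_assoc]
  gcongr ?_ * _
  have hx : 0 < 1 + ‖x‖ := by positivity
  rw [← ENNReal.mul_rpow_of_nonneg _ _ (by norm_num), ← ENNReal.ofReal_mul (by positivity)]
  have : (1 + ‖x‖) ^ (-((d : ℝ) + 1)) * (1 + ‖x‖) ^ (d + 3) = (1 + ‖x‖) ^ 2 := by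
    rw [← Real.rpow_natCast, ← Real.rpow_natCast, ← Real.rpow_add hx]
    congr 1; push_cast; ring
  rw [this, ENNReal.ofReal_rpow_of_nonneg (by positivity) (by norm_num), ← Real.sqrt_eq_rpow,
    Real.sqrt_sq hx.le, ← ofReal_norm]
  exact ENNReal.ofReal_le_ofReal (by linarith)

/-- The fluctuation of the empirical measure of independent points, in transport cost, at the
scale `ε`. -/
theorem exists_hasCouplingCost_sum_dirac (hX : ∀ k, Measurable (X k)) (hind : iIndepFun X P)
    (S : Finset ι) {A : ℝ≥0∞} (hA : ∀ k ∈ S, ∫⁻ ω, ENNReal.ofReal ((2 + ‖X k ω‖) ^ (d + 3)) ∂P ≤ A)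
    {ε : ℝ} (hε0 : 0 < ε) (hε1 : ε ≤ 1) :
    ∃ b : Ω → ℝ≥0∞, Measurable b ∧
      (∀ ω, HasCouplingCost (∑ k ∈ S, P.map (X k)) (∑ k ∈ S, Measure.dirac (X k ω)) (b ω)) ∧
      ∫⁻ ω, b ω ∂P ≤ 2 * ENNReal.ofReal ε * S.card
        + (volume (Metric.ball (0 : EuclideanSpace ℝ (Fin d)) ε))⁻¹
          * ((∫⁻ x : EuclideanSpace ℝ (Fin d), ENNReal.ofReal ((1 + ‖x‖) ^ (-((d : ℝ) + 1))))
                ^ (1 / 2 : ℝ)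
            * (volume (Metric.ball (0 : EuclideanSpace ℝ (Fin d)) ε) * (S.card * A))
                ^ (1 / 2 : ℝ)) := by
  have hprob : ∀ k, IsProbabilityMeasure (P.map (X k)) := fun k =>
    Measure.isProbabilityMeasure_map (hX k).aemeasurable
  set μ := ∑ k ∈ S, P.map (X k) with hμ
  set ν : Ω → Measure (EuclideanSpace ℝ (Fin d)) := fun ω => ∑ k ∈ S, Measure.dirac (X k ω) with hν
  have hμu : μ univ = S.card := by simp [hμ, Measure.finsetSum_apply]
  have hνu : ∀ ω, ν ω univ = S.card := fun ω => by simp [hν, Measure.finsetSum_apply]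
  have : IsFiniteMeasure μ := ⟨by rw [hμu]; exact ENNReal.natCast_lt_top _⟩
  have hνf : ∀ ω, IsFiniteMeasure (ν ω) := fun ω => ⟨by rw [hνu]; exact ENNReal.natCast_lt_top _⟩
  set V := volume (Metric.ball (0 : EuclideanSpace ℝ (Fin d)) ε) with hV
  have hV0 : V ≠ 0 := (Metric.measure_ball_pos _ _ hε0).ne'
  have hVt : V⁻¹ ≠ ∞ := ENNReal.inv_ne_top.2 hV0
  have hmμ : Measurable fun x => μ (Metric.ball x ε) := measurable_measure_ball μ ε
  have hmν : Measurable fun p : Ω × EuclideanSpace ℝ (Fin d) => ν p.1 (Metric.ball p.2 ε) := by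
    simp only [hν, Measure.finsetSum_apply]
    refine Finset.measurable_sum _ fun k _ => ?_
    have : ∀ p : Ω × EuclideanSpace ℝ (Fin d), Measure.dirac (X k p.1) (Metric.ball p.2 ε)
        = {p : Ω × EuclideanSpace ℝ (Fin d) | dist (X k p.1) p.2 < ε}.indicator
          (fun _ => (1 : ℝ≥0∞)) p := fun p => by
      rw [Measure.dirac_apply' _ Metric.isOpen_ball.measurableSet]
      by_cases h : dist (X k p.1) p.2 < ε <;> simp [h]
    simp_rw [this]
    have hXk := hX k
    exact measurable_const.indicator (measurableSet_lt (by fun_prop) (by fun_prop))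
  set D : Ω × EuclideanSpace ℝ (Fin d) → ℝ≥0∞ := fun p =>
    ‖p.2‖ₑ * ((μ (Metric.ball p.2 ε) - ν p.1 (Metric.ball p.2 ε))
      + (ν p.1 (Metric.ball p.2 ε) - μ (Metric.ball p.2 ε))) with hD
  have hmμ' : Measurable fun p : Ω × EuclideanSpace ℝ (Fin d) => μ (Metric.ball p.2 ε) :=
    hmμ.comp measurable_snd
  have hDm : Measurable D :=
    (by fun_prop : Measurable fun p : Ω × EuclideanSpace ℝ (Fin d) => ‖p.2‖ₑ).mul
      ((hmμ'.sub hmν).add (hmν.sub hmμ'))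
  have hDI : Measurable fun ω => ∫⁻ x, D (ω, x) := hDm.lintegral_prod_right'
  -- An explicit measurable majorant is carried along, so measurability of the Wasserstein distance
  -- in `ω` is never needed.
  refine ⟨fun ω => 2 * ENNReal.ofReal ε * S.card + V⁻¹ * ∫⁻ x, D (ω, x),
    (hDI.const_mul _).const_add _, fun ω => ?_, ?_⟩
  · rw [← hμu]
    exact hasCouplingCost_of_ball μ (ν ω) (by rw [hμu, hνu]) hε0
  · rw [lintegral_add_left (by fun_prop), lintegral_const_mul _ hDI]
    simp only [lintegral_const, measure_univ, mul_one]
    gcongr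
    rw [lintegral_lintegral_swap (f := fun ω x => D (ω, x)) hDm.aemeasurable]
    calc ∫⁻ x, ∫⁻ ω, D (ω, x) ∂P ≤ ∫⁻ x, ‖x‖ₑ * (μ (Metric.ball x ε)) ^ (1 / 2 : ℝ) := by
          refine lintegral_mono fun x => ?_
          simp only [hD]
          rw [lintegral_const_mul' _ _ enorm_ne_top]
          gcongr
          exact lintegral_sum_dirac_fluctuation_le hX hind S Metric.isOpen_ball.measurableSet
      _ ≤ _ := lintegral_norm_mul_rpow_half_le _ hmμ
      _ ≤ _ := by
          gcongr
          refine (lintegral_weight_mul_measure_ball_le μ hε1 (d + 3)).trans ?_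
          gcongr
          rw [hμ, lintegral_finsetSum_measure]
          calc ∑ k ∈ S, ∫⁻ y, ENNReal.ofReal ((2 + ‖y‖) ^ (d + 3)) ∂(P.map (X k))
              ≤ ∑ k ∈ S, A := Finset.sum_le_sum fun k hk => by
                rw [lintegral_map (by fun_prop) (hX k)]
                exact hA k hk
            _ = S.card * A := by simp

/-- Optimizing the scale: `n` independent points deviate from their mean law by at most
`C n ^ (1 - 1 / (d + 2))`, in unnormalized transport cost. -/
theorem exists_const_hasCouplingCost_sum_dirac (d : ℕ) {A : ℝ≥0∞} (hA : A ≠ ∞) :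
    ∃ C : ℝ≥0∞, C ≠ ∞ ∧ ∀ {Ω : Type*} {ι : Type} [MeasurableSpace Ω] {P : Measure Ω}
      [IsProbabilityMeasure P] {X : ι → Ω → EuclideanSpace ℝ (Fin d)},
      (∀ k, Measurable (X k)) → iIndepFun X P → ∀ S : Finset ι,
      (∀ k ∈ S, ∫⁻ ω, ENNReal.ofReal ((2 + ‖X k ω‖) ^ (d + 3)) ∂P ≤ A) →
      ∃ b : Ω → ℝ≥0∞, Measurable b ∧
        (∀ ω, HasCouplingCost (∑ k ∈ S, P.map (X k)) (∑ k ∈ S, Measure.dirac (X k ω)) (b ω)) ∧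
        ∫⁻ ω, b ω ∂P ≤ C * ENNReal.ofReal ((S.card : ℝ) ^ (1 - 1 / ((d : ℝ) + 2))) := by
  set I := ∫⁻ x : EuclideanSpace ℝ (Fin d), ENNReal.ofReal ((1 + ‖x‖) ^ (-((d : ℝ) + 1))) with hI
  have hIt : I ≠ ∞ := (finite_integral_one_add_norm (by simp)).ne
  set V₁ := volume (Metric.ball (0 : EuclideanSpace ℝ (Fin d)) 1) with hV₁
  have hV0 : V₁ ≠ 0 := (Metric.measure_ball_pos _ _ one_pos).ne'
  have hVt : V₁ ≠ ∞ := measure_ball_lt_top.ne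
  refine ⟨2 + V₁⁻¹ * (I ^ (1 / 2 : ℝ) * (V₁ * A) ^ (1 / 2 : ℝ)), ?_, ?_⟩
  · refine ENNReal.add_ne_top.2 ⟨by norm_num, ENNReal.mul_ne_top (ENNReal.inv_ne_top.2 hV0) ?_⟩
    exact ENNReal.mul_ne_top (ENNReal.rpow_ne_top_of_nonneg (by norm_num) hIt)
      (ENNReal.rpow_ne_top_of_nonneg (by norm_num) (ENNReal.mul_ne_top hVt hA))
  intro Ω ι _ P _ X hX hind S hS
  rcases S.eq_empty_or_nonempty with rfl | hne
  · refine ⟨fun _ => 0, measurable_const, fun ω => ?_, by simp⟩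
    simpa using HasCouplingCost.refl (0 : Measure (EuclideanSpace ℝ (Fin d)))
  have hn : (1 : ℝ) ≤ S.card := by exact_mod_cast hne.card_pos
  have hn0 : (0 : ℝ) < S.card := by linarith
  set n : ℝ := (S.card : ℝ) with hn'
  have hd : (0 : ℝ) < (d : ℝ) + 2 := by positivity
  -- This scale equates the smoothing cost `n * ε` with the fluctuation cost `n ^ (1/2) * ε ^
  -- (-d/2)`; both become `n ^ (1 - 1/(d+2))`.
  set ε : ℝ := n ^ (-(1 / ((d : ℝ) + 2))) with hε
  have hε0 : 0 < ε := by positivity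
  have hε1 : ε ≤ 1 := Real.rpow_le_one_of_one_le_of_nonpos hn (by
    have : 0 < 1 / ((d : ℝ) + 2) := by positivity
    linarith)
  obtain ⟨b, hbm, hb, hbI⟩ := exists_hasCouplingCost_sum_dirac hX hind S hS hε0 hε1
  refine ⟨b, hbm, hb, hbI.trans ?_⟩
  have hcard : (S.card : ℝ≥0∞) = ENNReal.ofReal n := by simp [hn']
  have hV : volume (Metric.ball (0 : EuclideanSpace ℝ (Fin d)) ε) = ENNReal.ofReal (ε ^ d) * V₁ := by
    rw [Measure.addHaar_ball_of_pos _ _ hε0, finrank_euclideanSpace_fin]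
  rw [hV, hcard, add_mul]
  refine add_le_add (le_of_eq ?_) (le_of_eq ?_)
  · rw [mul_assoc, ← ENNReal.ofReal_mul hε0.le]
    congr 2
    rw [hε, sub_eq_neg_add, Real.rpow_add hn0, Real.rpow_one]
  · have e1 : (ENNReal.ofReal (ε ^ d) * V₁)⁻¹ = ENNReal.ofReal ((ε ^ d)⁻¹) * V₁⁻¹ := by
      rw [ENNReal.mul_inv (Or.inl (by simp; positivity)) (Or.inl ENNReal.ofReal_ne_top),
        ENNReal.ofReal_inv_of_pos (by positivity)]
    have e2 : (ENNReal.ofReal (ε ^ d) * V₁ * (ENNReal.ofReal n * A)) ^ (1 / 2 : ℝ)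
        = ENNReal.ofReal ((ε ^ d * n) ^ (1 / 2 : ℝ)) * (V₁ * A) ^ (1 / 2 : ℝ) := by
      rw [← ENNReal.ofReal_rpow_of_nonneg (by positivity) (by norm_num),
        ← ENNReal.mul_rpow_of_nonneg _ _ (by norm_num), ENNReal.ofReal_mul (by positivity)]
      congr 1; ring
    have e3 : (ε ^ d)⁻¹ * (ε ^ d * n) ^ (1 / 2 : ℝ) = n ^ (1 - 1 / ((d : ℝ) + 2)) := by
      rw [hε, ← Real.rpow_natCast, ← Real.rpow_mul hn0.le, ← Real.rpow_neg hn0.le]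
      nth_rewrite 3 [← Real.rpow_one n]
      rw [← Real.rpow_add hn0, ← Real.rpow_mul hn0.le, ← Real.rpow_add hn0]
      congr 1
      field_simp
      ring
    rw [e1, e2, ← e3, ENNReal.ofReal_mul (by positivity)]
    ring

end Fluctuation

/-! ### Test functions: cutoffs and plane waves -/

section TestFunctions

variable {d : ℕ}

theorem abs_fderiv_apply_add_laplacian_le {ψ : EuclideanSpace ℝ (Fin d) → ℝ} {K : ℝ}
    (hK : ∀ i ≤ 2, ∀ x, ‖iteratedFDeriv ℝ i ψ x‖ ≤ K) (α x : EuclideanSpace ℝ (Fin d)) :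
    |fderiv ℝ ψ x α + (Δ ψ) x| ≤ K * ‖α‖ + d * K := by
  have h1 : |fderiv ℝ ψ x α| ≤ K * ‖α‖ := by
    rw [← Real.norm_eq_abs]
    refine ((fderiv ℝ ψ x).le_opNorm α).trans ?_
    gcongr
    rw [← norm_iteratedFDeriv_one]
    exact hK 1 (by norm_num) x
  have h2 : |(Δ ψ) x| ≤ d * K := by
    rw [InnerProductSpace.laplacian_eq_iteratedFDeriv_orthonormalBasis ψ
      (EuclideanSpace.basisFun (Fin d) ℝ)]
    refine (Finset.abs_sum_le_sum_abs _ _).trans ?_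
    refine (Finset.sum_le_sum (g := fun _ => K) fun i _ => ?_).trans (by simp)
    rw [← Real.norm_eq_abs]
    refine ((iteratedFDeriv ℝ 2 ψ x).le_opNorm _).trans ?_
    simpa [Fin.prod_univ_two] using hK 2 le_rfl x
  exact (abs_add_le _ _).trans (add_le_add h1 h2)

/-- With compact support, `C¹` regularity makes this function Lipschitz; its integral against `m s`
is then continuous in `s`. -/
theorem contDiff_fderiv_apply_add_laplacian {ψ : EuclideanSpace ℝ (Fin d) → ℝ}
    (hψ : ContDiff ℝ (⊤ : ℕ∞) ψ) (α : EuclideanSpace ℝ (Fin d)) :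
    ContDiff ℝ 1 fun x => fderiv ℝ ψ x α + (Δ ψ) x := by
  refine ContDiff.add ?_ ?_
  · exact (hψ.fderiv_right (m := 1) (by norm_cast)).clm_apply contDiff_const
  · rw [InnerProductSpace.laplacian_eq_iteratedFDeriv_orthonormalBasis ψ
      (EuclideanSpace.basisFun (Fin d) ℝ)]
    refine ContDiff.sum fun i _ => ?_
    have h : ContDiff ℝ 1 (iteratedFDeriv ℝ 2 ψ) :=
      hψ.iteratedFDeriv_right (by norm_cast)
    exact (ContinuousMultilinearMap.apply ℝ (fun _ : Fin 2 => EuclideanSpace ℝ (Fin d)) ℝ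
      _).contDiff.comp h

theorem hasCompactSupport_fderiv_apply_add_laplacian {ψ : EuclideanSpace ℝ (Fin d) → ℝ}
    (hψ : HasCompactSupport ψ) (α : EuclideanSpace ℝ (Fin d)) :
    HasCompactSupport fun x => fderiv ℝ ψ x α + (Δ ψ) x := by
  refine HasCompactSupport.add ?_ ?_
  · exact hψ.fderiv_apply ℝ α
  · rw [InnerProductSpace.laplacian_eq_iteratedFDeriv_orthonormalBasis ψ
      (EuclideanSpace.basisFun (Fin d) ℝ)]
    refine (hψ.iteratedFDeriv (𝕜 := ℝ) 2).mono fun x hx => ?_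
    simp only [Function.mem_support] at hx ⊢
    intro h0
    exact hx (by simp [h0])

/-- Smooth cutoff of a function at scale `n + 1`. -/
noncomputable def cutoff (φ : EuclideanSpace ℝ (Fin d) → ℝ) (n : ℕ) (x : EuclideanSpace ℝ (Fin d)) : ℝ :=
  (⟨1, 2, one_pos, one_lt_two⟩ : ContDiffBump (0 : EuclideanSpace ℝ (Fin d)))
    (((n : ℝ) + 1)⁻¹ • x) * φ x

theorem contDiff_cutoff {φ : EuclideanSpace ℝ (Fin d) → ℝ} (hφ : ContDiff ℝ (⊤ : ℕ∞) φ) (n : ℕ) :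
    ContDiff ℝ (⊤ : ℕ∞) (cutoff φ n) :=
  ((ContDiffBump.contDiff _).comp (contDiff_const_smul _)).mul hφ

theorem hasCompactSupport_cutoff (φ : EuclideanSpace ℝ (Fin d) → ℝ) (n : ℕ) :
    HasCompactSupport (cutoff φ n) := by
  refine HasCompactSupport.mul_right ?_
  have hn : ((n : ℝ) + 1)⁻¹ ≠ 0 := by positivity
  exact (ContDiffBump.hasCompactSupport _).comp_homeomorph (Homeomorph.smulOfNeZero _ hn)

/-- Equality on a neighbourhood, rather than at `x` alone, lets derivatives pass to the limit
pointwise too. -/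
theorem cutoff_eventuallyEq (φ : EuclideanSpace ℝ (Fin d) → ℝ) (x : EuclideanSpace ℝ (Fin d)) :
    ∀ᶠ n : ℕ in atTop, cutoff φ n =ᶠ[𝓝 x] φ := by
  filter_upwards [eventually_gt_atTop ⌈‖x‖⌉₊] with n hn
  have hx : ‖x‖ < (n : ℝ) + 1 := by
    have := (Nat.le_ceil ‖x‖).trans_lt (Nat.cast_lt.2 hn)
    linarith
  have hopen : {z : EuclideanSpace ℝ (Fin d) | ‖z‖ < (n : ℝ) + 1} ∈ 𝓝 x :=
    (isOpen_lt continuous_norm continuous_const).mem_nhds hx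
  filter_upwards [hopen] with z hz
  rw [cutoff, ContDiffBump.one_of_mem_closedBall, one_mul]
  rw [mem_closedBall_zero_iff, norm_smul, Real.norm_of_nonneg (by positivity)]
  rw [inv_mul_le_iff₀ (by positivity)]
  simpa using (le_of_lt hz)

/-- Dilating the bump by `n + 1 ≥ 1` can only shrink its derivatives, so the Leibniz rule gives a
bound uniform in `n`, as dominated convergence requires. -/
theorem exists_bound_iteratedFDeriv_cutoff {φ : EuclideanSpace ℝ (Fin d) → ℝ}
    (hφ : ContDiff ℝ (⊤ : ℕ∞) φ) {M : ℝ} (hM : ∀ i ≤ 2, ∀ x, ‖iteratedFDeriv ℝ i φ x‖ ≤ M) :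
    ∃ K : ℝ, ∀ n, ∀ i ≤ 2, ∀ x, ‖iteratedFDeriv ℝ i (cutoff φ n) x‖ ≤ K := by
  set χ : ContDiffBump (0 : EuclideanSpace ℝ (Fin d)) := ⟨1, 2, one_pos, one_lt_two⟩ with hχ
  have hχc : ContDiff ℝ (⊤ : ℕ∞) χ := χ.contDiff
  have hbd : ∀ i : ℕ, ∃ C, ∀ x, ‖iteratedFDeriv ℝ i χ x‖ ≤ C := fun i => by
    obtain ⟨C, hC⟩ := (χ.hasCompactSupport.iteratedFDeriv (𝕜 := ℝ) i).exists_bound_of_continuous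
      (hχc.continuous_iteratedFDeriv (by exact_mod_cast le_top))
    exact ⟨C, hC⟩
  choose C hC using hbd
  have hM0 : 0 ≤ M := (norm_nonneg _).trans (hM 0 (by norm_num) 0)
  have hC0 : ∀ i, 0 ≤ C i := fun i => (norm_nonneg _).trans (hC i 0)
  have hscale : ∀ (n i : ℕ) (x : EuclideanSpace ℝ (Fin d)),
      ‖iteratedFDeriv ℝ i (fun x => χ (((n : ℝ) + 1)⁻¹ • x)) x‖ ≤ C i := fun n i x => by
    set L : EuclideanSpace ℝ (Fin d) →L[ℝ] EuclideanSpace ℝ (Fin d) :=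
      ((n : ℝ) + 1)⁻¹ • ContinuousLinearMap.id ℝ _ with hL
    have hL1 : ‖L‖ ≤ 1 := by
      refine ContinuousLinearMap.opNorm_le_bound _ zero_le_one fun z => ?_
      rw [hL, smul_apply, norm_smul, Real.norm_of_nonneg (by positivity)]
      gcongr
      · exact inv_le_one_of_one_le₀ (by linarith [(Nat.cast_nonneg n : (0 : ℝ) ≤ n)])
      · exact le_rfl
    have : (fun x => χ (((n : ℝ) + 1)⁻¹ • x)) = χ ∘ L := by ext z; simp [hL]
    rw [this, L.iteratedFDeriv_comp_right hχc x (by exact_mod_cast le_top)]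
    refine (ContinuousMultilinearMap.norm_compContinuousLinearMap_le _ _).trans ?_
    rw [Finset.prod_const]
    calc _ ≤ C i * 1 := by
          gcongr
          · exact hC0 i
          · exact hC i _
          · exact pow_le_one₀ (norm_nonneg _) hL1
      _ = C i := mul_one _
  refine ⟨∑ j ∈ Finset.range 3, 2 * C j * M, fun n i hi x => ?_⟩
  have hsm : ContDiff ℝ (⊤ : ℕ∞) fun x => χ (((n : ℝ) + 1)⁻¹ • x) :=
    hχc.comp (contDiff_const_smul _)
  refine (norm_iteratedFDeriv_mul_le hsm hφ x (n := i) (by exact_mod_cast le_top)).trans ?_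
  calc _ ≤ ∑ j ∈ Finset.range (i + 1), 2 * C j * M := by
        refine Finset.sum_le_sum fun j hj => ?_
        have hch : (i.choose j : ℝ) ≤ 2 := by
          have : i.choose j ≤ 2 := by
            have hj' : j ≤ i := by simpa [Nat.lt_succ_iff] using hj
            interval_cases i <;> interval_cases j <;> decide
          exact_mod_cast this
        gcongr
        · exact mul_nonneg zero_le_two (hC0 j)
        · exact hscale n j x
        · exact hM (i - j) (by omega) x
    _ ≤ _ := by
        refine Finset.sum_le_sum_of_subset_of_nonneg ?_ fun j _ _ => ?_
        · exact Finset.range_mono (by omega)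
        · exact mul_nonneg (mul_nonneg zero_le_two (hC0 j)) hM0

variable (ξ : EuclideanSpace ℝ (Fin d)) {f : ℝ → ℝ}

theorem iteratedFDeriv_comp_inner_apply (hf : ContDiff ℝ (⊤ : ℕ∞) f) (i : ℕ)
    (x : EuclideanSpace ℝ (Fin d)) (v : Fin i → EuclideanSpace ℝ (Fin d)) :
    iteratedFDeriv ℝ i (fun x => f (inner ℝ ξ x)) x v
      = (∏ j, inner ℝ ξ (v j)) * iteratedDeriv i f (inner ℝ ξ x) := by
  have : (fun x => f (inner ℝ ξ x)) = f ∘ (innerSL ℝ ξ) := by ext z; simp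
  rw [this, (innerSL ℝ ξ).iteratedFDeriv_comp_right hf x (by exact_mod_cast le_top)]
  rw [ContinuousMultilinearMap.compContinuousLinearMap_apply,
    iteratedFDeriv_apply_eq_iteratedDeriv_mul_prod]
  simp

theorem norm_iteratedFDeriv_comp_inner_le (hf : ContDiff ℝ (⊤ : ℕ∞) f) (i : ℕ) {c : ℝ}
    (hc : ∀ r, |iteratedDeriv i f r| ≤ c) (x : EuclideanSpace ℝ (Fin d)) :
    ‖iteratedFDeriv ℝ i (fun x => f (inner ℝ ξ x)) x‖ ≤ c * ‖ξ‖ ^ i := by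
  have hc0 : 0 ≤ c := (abs_nonneg _).trans (hc 0)
  refine ContinuousMultilinearMap.opNorm_le_bound (by positivity) fun v => ?_
  rw [iteratedFDeriv_comp_inner_apply ξ hf, norm_mul, norm_prod, Real.norm_eq_abs (iteratedDeriv _ _ _)]
  calc _ ≤ (∏ j, ‖ξ‖ * ‖v j‖) * c := by
        gcongr with j
        · exact norm_inner_le_norm _ _
        · exact hc _
    _ = _ := by rw [Finset.prod_mul_distrib]; simp; ring

theorem laplacian_comp_inner (hf : ContDiff ℝ (⊤ : ℕ∞) f) (x : EuclideanSpace ℝ (Fin d)) :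
    (Δ fun x => f (inner ℝ ξ x)) x = ‖ξ‖ ^ 2 * iteratedDeriv 2 f (inner ℝ ξ x) := by
  rw [InnerProductSpace.laplacian_eq_iteratedFDeriv_orthonormalBasis _
      (EuclideanSpace.basisFun (Fin d) ℝ)]
  simp_rw [iteratedFDeriv_comp_inner_apply ξ hf]
  rw [← Finset.sum_mul, ← (EuclideanSpace.basisFun (Fin d) ℝ).sum_sq_norm_inner_left ξ]
  congr 1
  refine Finset.sum_congr rfl fun i _ => ?_
  simp [Fin.prod_univ_two, sq]

theorem fderiv_comp_inner (hf : ContDiff ℝ (⊤ : ℕ∞) f) (x α : EuclideanSpace ℝ (Fin d)) :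
    fderiv ℝ (fun x => f (inner ℝ ξ x)) x α = inner ℝ ξ α * deriv f (inner ℝ ξ x) := by
  have := iteratedFDeriv_comp_inner_apply ξ hf 1 x fun _ => α
  rw [iteratedFDeriv_one_apply] at this
  simpa using this

end TestFunctions

/-! ### Time continuity, bounded test functions and the mode ODE -/

section Duality

variable {d : ℕ}

/-- The easy half of Kantorovich duality, for each coupling, followed by Cauchy-Schwarz to pass from
first to second order cost. The constant `L + 1` instead of `L` is nonzero, so it can be divided out
before taking the infimum. -/
theorem enorm_integral_sub_le_wassersteinDist {μ ν : Measure (EuclideanSpace ℝ (Fin d))}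
    [IsProbabilityMeasure μ] [IsProbabilityMeasure ν] {f : EuclideanSpace ℝ (Fin d) → ℝ}
    {L : ℝ≥0} (hL : LipschitzWith L f) {K : ℝ} (hK : ∀ x, |f x| ≤ K) :
    ‖∫ x, f x ∂μ - ∫ x, f x ∂ν‖ₑ ≤ (L + 1) * wassersteinDist 2 μ ν := by
  have hL0 : (L + 1 : ℝ≥0∞) ≠ 0 := by simp
  have hLt : (L + 1 : ℝ≥0∞) ≠ ∞ := by simp
  set D := ‖∫ x, f x ∂μ - ∫ x, f x ∂ν‖ₑ with hD
  have key : ∀ π, IsCouplingOf μ ν π → (D / (L + 1)) ^ (2 : ℝ) ≤ ∫⁻ z, edist z.1 z.2 ^ (2 : ℝ) ∂π := by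
    rintro π ⟨h1, h2⟩
    have hπ : IsProbabilityMeasure π := ⟨by
      rw [← preimage_univ (f := Prod.fst), ← Measure.map_apply measurable_fst .univ, h1]
      exact measure_univ⟩
    have hfc := hL.continuous
    have i1 : Integrable (fun z : EuclideanSpace ℝ (Fin d) × EuclideanSpace ℝ (Fin d) => f z.1) π :=
      Integrable.of_bound (by fun_prop) K (Eventually.of_forall fun z => hK _)
    have i2 : Integrable (fun z : EuclideanSpace ℝ (Fin d) × EuclideanSpace ℝ (Fin d) => f z.2) π :=
      Integrable.of_bound (by fun_prop) K (Eventually.of_forall fun z => hK _)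
    have e : ∫ x, f x ∂μ - ∫ x, f x ∂ν = ∫ z, (f z.1 - f z.2) ∂π := by
      rw [integral_sub i1 i2, ← h1, ← h2, integral_map (by fun_prop) (by fun_prop),
        integral_map (by fun_prop) (by fun_prop)]
    have hD1 : D ≤ (L + 1) * ∫⁻ z, edist z.1 z.2 ∂π := by
      rw [hD, e, ← lintegral_const_mul' _ _ hLt]
      refine (enorm_integral_le_lintegral_enorm _).trans (lintegral_mono fun z => ?_)
      rw [← edist_eq_enorm_sub]
      refine (hL z.1 z.2).trans ?_
      gcongr
      exact le_self_add
    have hCS : ∫⁻ z, edist z.1 z.2 ∂π ≤ (∫⁻ z, edist z.1 z.2 ^ (2 : ℝ) ∂π) ^ (1 / 2 : ℝ) := by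
      have := lintegral_rpow_half_mul_le π (f := fun z => edist z.1 z.2 ^ (2 : ℝ))
        (g := fun _ => 1) (by fun_prop) (by fun_prop)
      simp only [← ENNReal.rpow_mul] at this
      simpa using this
    have h3 : D / (L + 1) ≤ (∫⁻ z, edist z.1 z.2 ^ (2 : ℝ) ∂π) ^ (1 / 2 : ℝ) :=
      ENNReal.div_le_of_le_mul' (hD1.trans (by gcongr))
    calc (D / (L + 1)) ^ (2 : ℝ)
        ≤ ((∫⁻ z, edist z.1 z.2 ^ (2 : ℝ) ∂π) ^ (1 / 2 : ℝ)) ^ (2 : ℝ) := by gcongr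
      _ = _ := by rw [← ENNReal.rpow_mul]; norm_num
  have h4 : (D / (L + 1)) ≤ wassersteinDist 2 μ ν := by
    rw [wassersteinDist]
    calc D / (L + 1) = ((D / (L + 1)) ^ (2 : ℝ)) ^ (1 / 2 : ℝ) := by
          rw [← ENNReal.rpow_mul]; norm_num
      _ ≤ _ := by
          gcongr
          exact le_iInf₂ key
  rw [mul_comm]
  exact (ENNReal.div_le_iff hL0 hLt).1 h4

namespace IsDriftedHeatSolution

variable {α : EuclideanSpace ℝ (Fin d)} {T : ℝ} {μ₀ : Measure (EuclideanSpace ℝ (Fin d))}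
  {m : ℝ → Measure (EuclideanSpace ℝ (Fin d))}

theorem continuousOn_integral (hm : IsDriftedHeatSolution α T μ₀ m)
    {f : EuclideanSpace ℝ (Fin d) → ℝ} {L : ℝ≥0} (hL : LipschitzWith L f) {K : ℝ}
    (hK : ∀ x, |f x| ≤ K) : ContinuousOn (fun s => ∫ x, f x ∂(m s)) (Icc 0 T) := by
  intro t ht
  have hpt := hm.isProbabilityMeasure t ht
  rw [ContinuousWithinAt, tendsto_iff_edist_tendsto_0]
  have h0 : Tendsto (fun s => ((L : ℝ≥0∞) + 1) * wassersteinDist 2 (m s) (m t)) (𝓝[Icc 0 T] t) (𝓝 0) := by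
    have := ENNReal.Tendsto.const_mul (a := (L : ℝ≥0∞) + 1) (hm.continuous t ht)
      (Or.inr (by simp))
    simpa using this
  refine tendsto_of_tendsto_of_tendsto_of_le_of_le' tendsto_const_nhds h0
    (Eventually.of_forall fun _ => bot_le) ?_
  filter_upwards [self_mem_nhdsWithin] with s hs
  have := hm.isProbabilityMeasure s hs
  rw [edist_eq_enorm_sub]
  exact enorm_integral_sub_le_wassersteinDist hL hK

/-- The weak formulation extends to smooth test functions with bounded derivatives. -/
theorem equation_of_bounded (hm : IsDriftedHeatSolution α T μ₀ m)
    {φ : EuclideanSpace ℝ (Fin d) → ℝ} (hφ : ContDiff ℝ (⊤ : ℕ∞) φ) {M : ℝ}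
    (hM : ∀ i ≤ 2, ∀ x, ‖iteratedFDeriv ℝ i φ x‖ ≤ M) {t : ℝ} (ht : t ∈ Icc 0 T) :
    ∫ x, φ x ∂(m t) = ∫ x, φ x ∂(m 0)
        + ∫ s in (0 : ℝ)..t, ∫ x, (fderiv ℝ φ x α + (Δ φ) x) ∂(m s) := by
  obtain ⟨K, hK⟩ := exists_bound_iteratedFDeriv_cutoff hφ hM
  have hcs := fun n => contDiff_cutoff hφ n
  have hsupp := fun n => hasCompactSupport_cutoff φ n
  have hbd : ∀ n x, |fderiv ℝ (cutoff φ n) x α + (Δ (cutoff φ n)) x| ≤ K * ‖α‖ + d * K :=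
    fun n x => abs_fderiv_apply_add_laplacian_le (hK n) α x
  have hsub : ∀ s ∈ Icc 0 t, s ∈ Icc 0 T := fun s hs => ⟨hs.1, hs.2.trans ht.2⟩
  have hlim0 : ∀ s ∈ Icc 0 T, Tendsto (fun n => ∫ x, cutoff φ n x ∂(m s)) atTop
      (𝓝 (∫ x, φ x ∂(m s))) := fun s hs => by
    have := hm.isProbabilityMeasure s hs
    refine tendsto_integral_of_dominated_convergence (fun _ => K)
      (fun n => (hcs n).continuous.aestronglyMeasurable) (integrable_const _)
      (fun n => Eventually.of_forall fun x => ?_) (Eventually.of_forall fun x => ?_)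
    · simpa using hK n 0 (by norm_num) x
    · exact tendsto_const_nhds.congr'
        ((cutoff_eventuallyEq φ x).mono fun n hn => hn.eq_of_nhds.symm)
  have hlim1 : ∀ s ∈ Icc 0 T, Tendsto
      (fun n => ∫ x, (fderiv ℝ (cutoff φ n) x α + (Δ (cutoff φ n)) x) ∂(m s)) atTop
      (𝓝 (∫ x, (fderiv ℝ φ x α + (Δ φ) x) ∂(m s))) := fun s hs => by
    have := hm.isProbabilityMeasure s hs
    refine tendsto_integral_of_dominated_convergence (fun _ => K * ‖α‖ + d * K)
      (fun n => (contDiff_fderiv_apply_add_laplacian (hcs n) α).continuous.aestronglyMeasurable)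
      (integrable_const _)
      (fun n => Eventually.of_forall fun x => hbd n x) (Eventually.of_forall fun x => ?_)
    refine tendsto_const_nhds.congr' ((cutoff_eventuallyEq φ x).mono fun n hn => ?_)
    simp only [hn.fderiv_eq, (InnerProductSpace.laplacian_congr_nhds hn).eq_of_nhds]
  have hlim2 : Tendsto (fun n => ∫ s in (0 : ℝ)..t,
      ∫ x, (fderiv ℝ (cutoff φ n) x α + (Δ (cutoff φ n)) x) ∂(m s)) atTop
      (𝓝 (∫ s in (0 : ℝ)..t, ∫ x, (fderiv ℝ φ x α + (Δ φ) x) ∂(m s))) := by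
    refine intervalIntegral.tendsto_integral_filter_of_dominated_convergence
      (fun _ => K * ‖α‖ + d * K) (Eventually.of_forall fun n => ?_)
      (Eventually.of_forall fun n => Eventually.of_forall fun s hs => ?_)
      intervalIntegrable_const (Eventually.of_forall fun s hs => ?_)
    -- Measurability in time of the integrand comes from its continuity on the interval.
    · obtain ⟨L, hL⟩ := (contDiff_fderiv_apply_add_laplacian (hcs n) α).lipschitzWith_of_hasCompactSupport
        (hasCompactSupport_fderiv_apply_add_laplacian (hsupp n) α) (by norm_num)
      rw [uIoc_of_le ht.1]
      refine ((hm.continuousOn_integral hL (hbd n)).mono fun s hs => ?_).aestronglyMeasurable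
        measurableSet_Ioc
      exact hsub s (Ioc_subset_Icc_self hs)
    · rw [uIoc_of_le ht.1] at hs
      have := hm.isProbabilityMeasure s (hsub s (Ioc_subset_Icc_self hs))
      refine (norm_integral_le_of_norm_le_const (C := K * ‖α‖ + d * K)
        (Eventually.of_forall fun x => hbd n x)).trans (by simp)
    · rw [uIoc_of_le ht.1] at hs
      exact hlim1 s (hsub s (Ioc_subset_Icc_self hs))
  refine tendsto_nhds_unique (hlim0 t ht) ?_
  simp_rw [fun n => hm.equation (cutoff φ n) (hcs n) (hsupp n) t ht]
  exact (hlim0 0 ⟨le_rfl, ht.1.trans ht.2⟩).add hlim2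

end IsDriftedHeatSolution

/-- Uniqueness for the linear system satisfied by the real and imaginary parts of a Fourier mode. -/
theorem eq_mul_exp_of_integral_eq {T a b : ℝ} {c s : ℝ → ℝ} (hc : ContinuousOn c (Icc 0 T))
    (hs : ContinuousOn s (Icc 0 T))
    (ec : ∀ t ∈ Icc 0 T, c t = c 0 + ∫ r in (0 : ℝ)..t, (-a * s r - b * c r))
    (es : ∀ t ∈ Icc 0 T, s t = s 0 + ∫ r in (0 : ℝ)..t, (a * c r - b * s r)) {t : ℝ}
    (ht : t ∈ Icc 0 T) :
    (c t + s t * Complex.I : ℂ)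
      = (c 0 + s 0 * Complex.I) * Complex.exp ((a * Complex.I - b) * t) := by
  have hT : 0 ≤ T := ht.1.trans ht.2
  -- Constant extension beyond the interval gives continuous integrands on the whole line, so the
  -- primitives `u` and `v` are differentiable everywhere, endpoints included.
  set c' : ℝ → ℝ := IccExtend hT (domRestrict (Icc 0 T) c) with hc'
  set s' : ℝ → ℝ := IccExtend hT (domRestrict (Icc 0 T) s) with hs'
  have cc : Continuous c' := (continuousOn_iff_continuous_domRestrict.1 hc).Icc_extend'
  have cs : Continuous s' := (continuousOn_iff_continuous_domRestrict.1 hs).Icc_extend'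
  have cE : ∀ r ∈ Icc 0 T, c' r = c r := fun r hr => by
    rw [hc', IccExtend_of_mem _ _ hr]; rfl
  have sE : ∀ r ∈ Icc 0 T, s' r = s r := fun r hr => by
    rw [hs', IccExtend_of_mem _ _ hr]; rfl
  set u : ℝ → ℝ := fun t => c 0 + ∫ r in (0 : ℝ)..t, (-a * s' r - b * c' r) with hu
  set v : ℝ → ℝ := fun t => s 0 + ∫ r in (0 : ℝ)..t, (a * c' r - b * s' r) with hv
  have uE : ∀ r ∈ Icc 0 T, u r = c r := fun r hr => by
    rw [ec r hr]
    refine congrArg (c 0 + ·) ?_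
    refine intervalIntegral.integral_congr fun q hq => ?_
    rw [uIcc_of_le hr.1] at hq
    have hq' : q ∈ Icc 0 T := ⟨hq.1, hq.2.trans hr.2⟩
    simp only [cE q hq', sE q hq']
  have vE : ∀ r ∈ Icc 0 T, v r = s r := fun r hr => by
    rw [es r hr]
    refine congrArg (s 0 + ·) ?_
    refine intervalIntegral.integral_congr fun q hq => ?_
    rw [uIcc_of_le hr.1] at hq
    have hq' : q ∈ Icc 0 T := ⟨hq.1, hq.2.trans hr.2⟩
    simp only [cE q hq', sE q hq']
  have du : ∀ r, HasDerivAt u (-a * s' r - b * c' r) r := fun r => by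
    refine HasDerivAt.const_add _ ?_
    exact intervalIntegral.integral_hasDerivAt_right
      (Continuous.intervalIntegrable (by fun_prop) _ _)
      (Continuous.stronglyMeasurableAtFilter (by fun_prop) _ _) (by fun_prop)
  have dv : ∀ r, HasDerivAt v (a * c' r - b * s' r) r := fun r => by
    refine HasDerivAt.const_add _ ?_
    exact intervalIntegral.integral_hasDerivAt_right
      (Continuous.intervalIntegrable (by fun_prop) _ _)
      (Continuous.stronglyMeasurableAtFilter (by fun_prop) _ _) (by fun_prop)
  set κ : ℂ := a * Complex.I - b with hκ
  -- Integrating factor: `u + i v` solves `z' = κ z` on the interval, so this product is constant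
  -- there.
  set w : ℝ → ℂ := fun r => (u r + v r * Complex.I) * Complex.exp (-κ * r) with hw
  have dw : ∀ r, HasDerivAt w
      (((-a * s' r - b * c' r : ℝ) + (a * c' r - b * s' r : ℝ) * Complex.I) * Complex.exp (-κ * r)
        + (u r + v r * Complex.I) * (Complex.exp (-κ * r) * (-κ * 1))) r := fun r => by
    refine HasDerivAt.mul ?_ ?_
    · exact ((du r).ofReal_comp).add (((dv r).ofReal_comp).mul_const _)
    · exact (((hasDerivAt_id r).ofReal_comp).const_mul (-κ)).cexp
  have hw0 : ∀ r ∈ Icc 0 T, w r = w 0 := by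
    refine constant_of_has_deriv_right_zero
      (fun r _ => (dw r).continuousAt.continuousWithinAt) fun r hr => ?_
    have hr' : r ∈ Icc 0 T := Ico_subset_Icc_self hr
    convert (dw r).hasDerivWithinAt using 1
    rw [cE r hr', sE r hr', uE r hr', vE r hr', hκ]
    push_cast
    linear_combination (a * s r * Complex.exp (-(a * Complex.I - b) * r) : ℂ) * Complex.I_sq
  have h0 : (0 : ℝ) ∈ Icc 0 T := ⟨le_rfl, hT⟩
  have := hw0 t ht
  simp only [hw, uE t ht, vE t ht, uE 0 h0, vE 0 h0] at this
  simp only [Complex.ofReal_zero, mul_zero, Complex.exp_zero, mul_one] at this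
  rw [← this, mul_assoc, ← Complex.exp_add]
  simp

end Duality

/-! ### Identification of the solution by characteristic functions -/

section FourierMode

variable {d : ℕ}

namespace IsDriftedHeatSolution

variable {α : EuclideanSpace ℝ (Fin d)} {T : ℝ} {μ₀ : Measure (EuclideanSpace ℝ (Fin d))}
  {m : ℝ → Measure (EuclideanSpace ℝ (Fin d))}

theorem equation_comp_inner (hm : IsDriftedHeatSolution α T μ₀ m) (ξ : EuclideanSpace ℝ (Fin d))
    {f f₁ f₂ : ℝ → ℝ} (hf : ContDiff ℝ (⊤ : ℕ∞) f) (h1 : deriv f = f₁) (h2 : deriv f₁ = f₂)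
    (b0 : ∀ r, |f r| ≤ 1) (b1 : ∀ r, |f₁ r| ≤ 1) (b2 : ∀ r, |f₂ r| ≤ 1) {t : ℝ}
    (ht : t ∈ Icc 0 T) :
    ∫ x, f (inner ℝ ξ x) ∂(m t) = ∫ x, f (inner ℝ ξ x) ∂(m 0)
      + ∫ s in (0 : ℝ)..t, ∫ x, (inner ℝ ξ α * f₁ (inner ℝ ξ x)
        + ‖ξ‖ ^ 2 * f₂ (inner ℝ ξ x)) ∂(m s) := by
  have hφ : ContDiff ℝ (⊤ : ℕ∞) fun x : EuclideanSpace ℝ (Fin d) => f (inner ℝ ξ x) :=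
    hf.comp (innerSL ℝ ξ).contDiff
  have i2 : iteratedDeriv 2 f = f₂ := by
    rw [iteratedDeriv_succ, iteratedDeriv_one, h1, h2]
  have hb : ∀ i ≤ 2, ∀ x : EuclideanSpace ℝ (Fin d),
      ‖iteratedFDeriv ℝ i (fun x => f (inner ℝ ξ x)) x‖ ≤ max 1 ‖ξ‖ ^ 2 := by
    intro i hi x
    have hbd : ∀ r, |iteratedDeriv i f r| ≤ 1 := by
      intro r
      interval_cases i
      · simpa using b0 r
      · simpa [iteratedDeriv_one, h1] using b1 r
      · rw [i2]; exact b2 r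
    refine (norm_iteratedFDeriv_comp_inner_le ξ hf i hbd x).trans ?_
    rw [one_mul]
    calc ‖ξ‖ ^ i ≤ max 1 ‖ξ‖ ^ i := by gcongr; exact le_max_right _ _
      _ ≤ max 1 ‖ξ‖ ^ 2 := pow_le_pow_right₀ (le_max_left _ _) hi
  have := hm.equation_of_bounded hφ hb ht
  simpa only [fderiv_comp_inner ξ hf, laplacian_comp_inner ξ hf, i2, h1] using this

theorem charFun_eq (hm : IsDriftedHeatSolution α T μ₀ m) (ξ : EuclideanSpace ℝ (Fin d)) {t : ℝ}
    (ht : t ∈ Icc 0 T) :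
    charFun (m t) ξ = charFun (m 0) ξ
      * Complex.exp (((inner ℝ ξ α : ℝ) * Complex.I - (‖ξ‖ ^ 2 : ℝ)) * t) := by
  have hlip : LipschitzWith ‖ξ‖₊ fun x : EuclideanSpace ℝ (Fin d) => inner ℝ ξ x := by
    have hn : ‖innerSL ℝ ξ‖₊ = ‖ξ‖₊ := NNReal.eq (innerSL_apply_norm ℝ ξ)
    exact hn ▸ (innerSL ℝ ξ).lipschitz
  have lc : LipschitzWith (1 * ‖ξ‖₊) fun x : EuclideanSpace ℝ (Fin d) => Real.cos (inner ℝ ξ x) :=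
    Real.lipschitzWith_cos.comp hlip
  have ls : LipschitzWith (1 * ‖ξ‖₊) fun x : EuclideanSpace ℝ (Fin d) => Real.sin (inner ℝ ξ x) :=
    Real.lipschitzWith_sin.comp hlip
  have ic : ∀ s ∈ Icc 0 T, Integrable (fun x => Real.cos (inner ℝ ξ x)) (m s) := fun s hs => by
    have := hm.isProbabilityMeasure s hs
    exact Integrable.of_bound (by fun_prop) 1 (Eventually.of_forall fun x => Real.abs_cos_le_one _)
  have is : ∀ s ∈ Icc 0 T, Integrable (fun x => Real.sin (inner ℝ ξ x)) (m s) := fun s hs => by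
    have := hm.isProbabilityMeasure s hs
    exact Integrable.of_bound (by fun_prop) 1 (Eventually.of_forall fun x => Real.abs_sin_le_one _)
  have hchar : ∀ s ∈ Icc 0 T, charFun (m s) ξ
      = ((∫ x, Real.cos (inner ℝ ξ x) ∂(m s) : ℝ) : ℂ)
        + ((∫ x, Real.sin (inner ℝ ξ x) ∂(m s) : ℝ) : ℂ) * Complex.I := fun s hs => by
    rw [charFun_apply, ← integral_complex_ofReal, ← integral_complex_ofReal,
      ← integral_mul_const, ← integral_add (ic s hs).ofReal ((is s hs).ofReal.mul_const _)]
    refine integral_congr_ae (Eventually.of_forall fun x => ?_)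
    simp only [Complex.exp_mul_I, Complex.ofReal_cos, Complex.ofReal_sin, real_inner_comm x ξ]
  have h0 : (0 : ℝ) ∈ Icc 0 T := ⟨le_rfl, ht.1.trans ht.2⟩
  rw [hchar t ht, hchar 0 h0]
  refine eq_mul_exp_of_integral_eq (T := T)
    (c := fun s => ∫ x, Real.cos (inner ℝ ξ x) ∂(m s))
    (s := fun s => ∫ x, Real.sin (inner ℝ ξ x) ∂(m s))
    (hm.continuousOn_integral lc fun x => Real.abs_cos_le_one _)
    (hm.continuousOn_integral ls fun x => Real.abs_sin_le_one _) (fun r hr => ?_) (fun r hr => ?_) ht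
  · rw [hm.equation_comp_inner ξ (f := Real.cos) (f₁ := fun r => -Real.sin r)
      (f₂ := fun r => -Real.cos r) Real.contDiff_cos (by ext; simp) (by ext; simp)
      Real.abs_cos_le_one (by simpa using Real.abs_sin_le_one) (by simpa using Real.abs_cos_le_one)
      hr]
    congr 1
    refine intervalIntegral.integral_congr fun q hq => ?_
    rw [uIcc_of_le hr.1] at hq
    have hq' : q ∈ Icc 0 T := ⟨hq.1, hq.2.trans hr.2⟩
    simp only [mul_neg, ← neg_mul]
    rw [integral_add ((is q hq').const_mul _) ((ic q hq').const_mul _),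
      integral_const_mul, integral_const_mul]
    ring
  · rw [hm.equation_comp_inner ξ (f := Real.sin) (f₁ := Real.cos)
      (f₂ := fun r => -Real.sin r) Real.contDiff_sin (by ext; simp) (by ext; simp)
      Real.abs_sin_le_one Real.abs_cos_le_one (by simpa using Real.abs_sin_le_one)
      hr]
    congr 1
    refine intervalIntegral.integral_congr fun q hq => ?_
    rw [uIcc_of_le hr.1] at hq
    have hq' : q ∈ Icc 0 T := ⟨hq.1, hq.2.trans hr.2⟩
    simp only [mul_neg, ← neg_mul]
    rw [integral_add ((ic q hq').const_mul _) ((is q hq').const_mul _),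
      integral_const_mul, integral_const_mul]
    ring

end IsDriftedHeatSolution

namespace IsStdBrownianMotion

variable {Ω : Type*} [MeasurableSpace Ω] {P : Measure Ω} {B : ℝ≥0 → Ω → EuclideanSpace ℝ (Fin d)}

theorem aemeasurable (hB : IsStdBrownianMotion B P) (t : ℝ≥0) : AEMeasurable (B t) P := by
  have h : AEMeasurable (fun ω => (WithLp.ofLp (B t ω))) P :=
    aemeasurable_pi_lambda _ fun i => (hB.coord i).aemeasurable t
  exact (MeasurableEquiv.toLp 2 (Fin d → ℝ)).measurable.comp_aemeasurable h

theorem charFun_map [IsProbabilityMeasure P] (hB : IsStdBrownianMotion B P) (t : ℝ≥0) (ξ : EuclideanSpace ℝ (Fin d)) :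
    charFun (P.map (B t)) ξ = Complex.exp (-(t * ‖ξ‖ ^ 2 / 2 : ℝ)) := by
  have hind : iIndepFun (fun (i : Fin d) ω => B t ω i) P :=
    hB.indep.comp (fun _ w => w t) fun _ => measurable_pi_apply t
  have h := (iIndepFun_iff_charFun_pi fun i => (hB.coord i).aemeasurable t).1 hind ξ
  rw [show B t = fun ω => WithLp.toLp 2 fun i => B t ω i from rfl, h]
  simp_rw [fun i => ((hB.coord i).hasLaw_eval t).map_eq, charFun_gaussianReal]
  rw [← Complex.exp_sum]
  congr 1
  rw [EuclideanSpace.real_norm_sq_eq]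
  push_cast
  rw [Finset.mul_sum, Finset.sum_div, ← Finset.sum_neg_distrib]
  refine Finset.sum_congr rfl fun i _ => ?_
  simp

/-- Brownian scaling reduces all moment bounds to those of one fixed Gaussian, independent of time.
-/
theorem map_eq [IsProbabilityMeasure P] (hB : IsStdBrownianMotion B P) (t : ℝ≥0) :
    P.map (B t) = (stdGaussian (EuclideanSpace ℝ (Fin d))).map (√(t : ℝ) • ·) := by
  have : IsProbabilityMeasure (P.map (B t)) := Measure.isProbabilityMeasure_map (hB.aemeasurable t)
  have : IsProbabilityMeasure ((stdGaussian (EuclideanSpace ℝ (Fin d))).map (√(t : ℝ) • ·)) :=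
    Measure.isProbabilityMeasure_map (by fun_prop)
  refine Measure.ext_of_charFun ?_
  ext ξ
  rw [hB.charFun_map, charFun_map_smul, charFun_stdGaussian, norm_smul,
    Real.norm_of_nonneg (Real.sqrt_nonneg _)]
  congr 1
  rw [← Complex.ofReal_pow, mul_pow, Real.sq_sqrt t.coe_nonneg]
  push_cast
  ring

end IsStdBrownianMotion

theorem charFun_smul_sum {ι E : Type*} [MeasurableSpace E] [NormedAddCommGroup E]
    [InnerProductSpace ℝ E] [BorelSpace E] [SecondCountableTopology E] (s : Finset ι)
    (μ : ι → Measure E) [∀ i, IsFiniteMeasure (μ i)] (c : ℝ≥0∞) (ξ : E) :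
    charFun (c • ∑ i ∈ s, μ i) ξ = c.toReal * ∑ i ∈ s, charFun (μ i) ξ := by
  simp_rw [charFun_apply]
  rw [integral_smul_measure, integral_finsetSum_measure]
  · simp
  · intro i _
    refine Integrable.of_bound (by fun_prop) 1 (Eventually.of_forall fun x => ?_)
    rw [Complex.norm_exp_ofReal_mul_I]

theorem IsStdBrownianMotion.aemeasurable_affine {Ω : Type*} [MeasurableSpace Ω] {P : Measure Ω}
    {B : ℝ≥0 → Ω → EuclideanSpace ℝ (Fin d)}
    (hB : IsStdBrownianMotion B P) (t : ℝ≥0) (z : EuclideanSpace ℝ (Fin d)) :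
    AEMeasurable (fun ω => z + √2 • B t ω) P := by
  have h := hB.aemeasurable t
  have h2 : Measurable fun x : EuclideanSpace ℝ (Fin d) => z + √2 • x := by fun_prop
  exact h2.comp_aemeasurable h

theorem IsStdBrownianMotion.charFun_map_affine {Ω : Type*} [MeasurableSpace Ω] {P : Measure Ω}
    [IsProbabilityMeasure P] {B : ℝ≥0 → Ω → EuclideanSpace ℝ (Fin d)}
    (hB : IsStdBrownianMotion B P) (t : ℝ≥0) (z ξ : EuclideanSpace ℝ (Fin d)) :
    charFun (P.map fun ω => z + √2 • B t ω) ξ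
      = Complex.exp ((inner ℝ z ξ : ℝ) * Complex.I - (t * ‖ξ‖ ^ 2 : ℝ)) := by
  have hBm := hB.aemeasurable t
  have e : P.map (fun ω => z + √2 • B t ω) = (P.map fun ω => √2 • B t ω).map (z + ·) := by
    exact (AEMeasurable.map_map_of_aemeasurable (by fun_prop)
      (f := fun ω => √2 • B t ω) (hBm.const_smul √2)).symm
  rw [e, charFun_map_const_add, charFun_map_smul_comp hBm, hB.charFun_map, ← Complex.exp_add,
    norm_smul, Real.norm_of_nonneg (Real.sqrt_nonneg _), mul_pow, Real.sq_sqrt zero_le_two]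
  congr 1
  push_cast
  ring

/-- Uniqueness for the equation and the Gaussian formula meet in Fourier space: the increment `√2 •
B` has covariance `2 h` times the identity, hence exactly the damping `exp (-h ‖ξ‖ ^ 2)` of the
mode. -/
theorem IsDriftedHeatSolution.eq_average_map {α : EuclideanSpace ℝ (Fin d)} {T : ℝ} {N : ℕ}
    (hN : 1 ≤ N) {y : Fin N → EuclideanSpace ℝ (Fin d)}
    {m : ℝ → Measure (EuclideanSpace ℝ (Fin d))}
    (hm : IsDriftedHeatSolution α T (empiricalMeasure y) m)
    {Ω : Type*} [MeasurableSpace Ω] {P : Measure Ω} [IsProbabilityMeasure P]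
    {B : Fin N → ℝ≥0 → Ω → EuclideanSpace ℝ (Fin d)} (hB : ∀ k, IsStdBrownianMotion (B k) P)
    {h : ℝ≥0} (hh : (h : ℝ) ≤ T) :
    m h = (N : ℝ≥0∞)⁻¹ • ∑ k, P.map fun ω => y k + (h : ℝ) • α + √2 • B k h ω := by
  have hmem : (h : ℝ) ∈ Icc 0 T := ⟨h.2, hh⟩
  have hpm : ∀ k, IsProbabilityMeasure (P.map fun ω => y k + (h : ℝ) • α + √2 • B k h ω) :=
    fun k => Measure.isProbabilityMeasure_map ((hB k).aemeasurable_affine h _)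
  have := hm.isProbabilityMeasure h hmem
  have hN0 : (N : ℝ≥0∞)⁻¹ ≠ ∞ := ENNReal.inv_ne_top.2 (by
    exact_mod_cast (Nat.one_le_iff_ne_zero.1 hN))
  have : IsFiniteMeasure ((N : ℝ≥0∞)⁻¹ • ∑ k, P.map fun ω => y k + (h : ℝ) • α + √2 • B k h ω) :=
    Measure.smul_finite _ hN0
  refine Measure.ext_of_charFun ?_
  ext ξ
  rw [hm.charFun_eq ξ hmem, hm.initial, empiricalMeasure, charFun_smul_sum, charFun_smul_sum,
    mul_assoc, Finset.sum_mul]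
  refine congrArg _ (Finset.sum_congr rfl fun k _ => ?_)
  rw [(hB k).charFun_map_affine, charFun_dirac, ← Complex.exp_add, inner_add_left,
    real_inner_smul_left, real_inner_comm ξ α]
  congr 1
  push_cast
  ring

end FourierMode

/-! ### Clusters of Gaussian points -/

section Groups

theorem lintegral_stdGaussian_pow_ne_top (d n : ℕ) (a b : ℝ) (ha : 0 ≤ a) (hb : 0 ≤ b) :
    ∫⁻ x, ENNReal.ofReal ((a + b * ‖x‖) ^ n) ∂(stdGaussian (EuclideanSpace ℝ (Fin d))) ≠ ∞ := by
  have h1 : MemLp (fun x : EuclideanSpace ℝ (Fin d) => a + b * ‖x‖) n (stdGaussian _) :=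
    (memLp_const a).add
      (((IsGaussian.memLp_id (stdGaussian (EuclideanSpace ℝ (Fin d))) n (by simp)).norm).const_mul b)
  have h2 := h1.integrable_norm_pow'
  have h3 : Integrable (fun x : EuclideanSpace ℝ (Fin d) => (a + b * ‖x‖) ^ n)
      (stdGaussian (EuclideanSpace ℝ (Fin d))) := by
    refine h2.congr (Eventually.of_forall fun x => ?_)
    simp only [Real.norm_eq_abs]
    rw [abs_of_nonneg (by positivity)]
  exact h3.lintegral_lt_top.ne

/-- Fluctuation of a cluster of independent Gaussian points whose means lie at distance
`√d * r` from a common center, where `r` is the standard deviation. -/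
theorem exists_const_hasCouplingCost_cluster (d : ℕ) :
    ∃ C : ℝ≥0∞, C ≠ ∞ ∧ ∀ {Ω : Type*} {ι : Type} [MeasurableSpace Ω] {P : Measure Ω}
      [IsProbabilityMeasure P] {Z : ι → Ω → EuclideanSpace ℝ (Fin d)} {r : ℝ}, 0 < r →
      (∀ k, Measurable (Z k)) → iIndepFun Z P →
      (∀ k, P.map (Z k) = (stdGaussian (EuclideanSpace ℝ (Fin d))).map (r • ·)) →
      ∀ (S : Finset ι) (z : ι → EuclideanSpace ℝ (Fin d)) (c : EuclideanSpace ℝ (Fin d)),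
      (∀ k ∈ S, ‖z k - c‖ ≤ √d * r) →
      ∃ b : Ω → ℝ≥0∞, Measurable b ∧
        (∀ ω, HasCouplingCost (∑ k ∈ S, P.map fun ω => z k + √2 • Z k ω)
          (∑ k ∈ S, Measure.dirac (z k + √2 • Z k ω)) (b ω)) ∧
        ∫⁻ ω, b ω ∂P
          ≤ C * ENNReal.ofReal (r * (S.card : ℝ) ^ (1 - 1 / ((d : ℝ) + 2))) := by
  obtain ⟨C, hC, H⟩ := exists_const_hasCouplingCost_sum_dirac d
    (lintegral_stdGaussian_pow_ne_top d (d + 3) (2 + √d) √2 (by positivity) (by positivity))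
  refine ⟨C, hC, ?_⟩
  intro Ω ι _ P _ Z r hr hZ hind hlaw S z c hS
  -- After recentring and division by `r`, the norm is dominated by `√d + √2 ‖x‖` with `x` standard
  -- Gaussian, so one moment bound serves every `r`. Undoing the scaling multiplies the cost by `r`.
  set X : ι → Ω → EuclideanSpace ℝ (Fin d) := fun k ω => r⁻¹ • (z k - c + √2 • Z k ω) with hX
  have hXm : ∀ k, Measurable (X k) := fun k => by
    have := hZ k
    fun_prop
  have hXi : iIndepFun X P :=
    hind.comp (fun k x => r⁻¹ • (z k - c + √2 • x)) fun k => by fun_prop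
  obtain ⟨b, hbm, hb, hbI⟩ := H hXm hXi S fun k hk => by
    have e : ∫⁻ ω, ENNReal.ofReal ((2 + ‖X k ω‖) ^ (d + 3)) ∂P
        = ∫⁻ x, ENNReal.ofReal ((2 + ‖r⁻¹ • (z k - c + √2 • (r • x))‖) ^ (d + 3))
          ∂(stdGaussian (EuclideanSpace ℝ (Fin d))) := by
      rw [← lintegral_map (μ := stdGaussian (EuclideanSpace ℝ (Fin d)))
        (f := fun x => ENNReal.ofReal ((2 + ‖r⁻¹ • (z k - c + √2 • x)‖) ^ (d + 3)))
        (g := fun x => r • x) (by fun_prop) (by fun_prop), ← hlaw k,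
        lintegral_map (by fun_prop) (hZ k)]
    rw [e]
    refine lintegral_mono fun x => ENNReal.ofReal_le_ofReal ?_
    gcongr ?_ ^ _
    rw [add_assoc]
    gcongr
    have h1 : r⁻¹ • (z k - c + √2 • (r • x)) = r⁻¹ • (z k - c) + √2 • x := by
      rw [smul_add, smul_comm √2 r x, inv_smul_smul₀ hr.ne']
    rw [h1]
    refine (norm_add_le _ _).trans ?_
    rw [norm_smul, norm_smul, Real.norm_of_nonneg (by positivity), Real.norm_of_nonneg (by positivity)]
    gcongr
    rw [inv_mul_le_iff₀ hr, mul_comm]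
    exact hS k hk
  set f : EuclideanSpace ℝ (Fin d) → EuclideanSpace ℝ (Fin d) := fun x => c + r • x with hf
  have hfm : Measurable f := by fun_prop
  have hfl : LipschitzWith r.toNNReal f := by
    refine LipschitzWith.of_dist_le_mul fun x y => ?_
    rw [hf, dist_add_left, dist_smul₀, Real.norm_of_nonneg hr.le, Real.coe_toNNReal _ hr.le]
  have hfX : ∀ k ω, f (X k ω) = z k + √2 • Z k ω := fun k ω => by
    simp only [hf, hX]
    rw [smul_inv_smul₀ hr.ne']; abel
  refine ⟨fun ω => r.toNNReal * b ω, hbm.const_mul _, fun ω => ?_, ?_⟩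
  · have := (hb ω).map_lipschitz hfl
    rw [Measure.map_finset_sum hfm.aemeasurable, Measure.map_finset_sum hfm.aemeasurable] at this
    convert this using 3 with k hk k hk
    · rw [Measure.map_map hfm (hXm k)]
      congr 1; ext1 ω; exact (hfX k ω).symm
    · rw [Measure.map_dirac' hfm, hfX]
  · rw [lintegral_const_mul _ hbm]
    refine (mul_le_mul_right hbI _).trans (le_of_eq ?_)
    rw [ENNReal.ofReal_mul hr.le, ← mul_assoc, ← mul_assoc, mul_comm C]
    rfl

/-- The label classes partition the points, and costs of couplings add; subfamilies of independent
points need no further argument. -/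
theorem exists_const_hasCouplingCost_labelled (d : ℕ) :
    ∃ C : ℝ≥0∞, C ≠ ∞ ∧ ∀ {Ω : Type*} {ι γ : Type} [Fintype ι] [DecidableEq γ] [MeasurableSpace Ω]
      {P : Measure Ω} [IsProbabilityMeasure P] {Z : ι → Ω → EuclideanSpace ℝ (Fin d)} {r : ℝ},
      0 < r → (∀ k, Measurable (Z k)) → iIndepFun Z P →
      (∀ k, P.map (Z k) = (stdGaussian (EuclideanSpace ℝ (Fin d))).map (r • ·)) →
      ∀ (z : ι → EuclideanSpace ℝ (Fin d)) (g : ι → γ) (c : γ → EuclideanSpace ℝ (Fin d)),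
      (∀ k, ‖z k - c (g k)‖ ≤ √d * r) →
      ∃ b : Ω → ℝ≥0∞, Measurable b ∧
        (∀ ω, HasCouplingCost (∑ k, P.map fun ω => z k + √2 • Z k ω)
          (∑ k, Measure.dirac (z k + √2 • Z k ω)) (b ω)) ∧
        ∫⁻ ω, b ω ∂P ≤ C * ENNReal.ofReal (r * ∑ q ∈ Finset.univ.image g,
          ((Finset.univ.filter fun k => g k = q).card : ℝ) ^ (1 - 1 / ((d : ℝ) + 2))) := by
  obtain ⟨C, hC, H⟩ := exists_const_hasCouplingCost_cluster d
  refine ⟨C, hC, ?_⟩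
  intro Ω ι γ _ _ _ P _ Z r hr hZ hind hlaw z g c hc
  choose b hbm hb hbI using fun q => H hr hZ hind hlaw (Finset.univ.filter fun k => g k = q) z (c q)
    fun k hk => by rw [← (Finset.mem_filter.1 hk).2]; exact hc k
  have hmaps : ∀ k ∈ (Finset.univ : Finset ι), g k ∈ Finset.univ.image g := fun k hk =>
    Finset.mem_image_of_mem g hk
  refine ⟨fun ω => ∑ q ∈ Finset.univ.image g, b q ω,
    Finset.measurable_sum _ fun q _ => hbm q, fun ω => ?_, ?_⟩
  · rw [← Finset.sum_fiberwise_of_maps_to hmaps, ← Finset.sum_fiberwise_of_maps_to hmaps]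
    exact HasCouplingCost.sum _ fun q _ => hb q ω
  · rw [lintegral_finsetSum _ fun q _ => hbm q, Finset.mul_sum,
      ENNReal.ofReal_sum_of_nonneg fun q _ => by positivity, Finset.mul_sum]
    exact Finset.sum_le_sum fun q _ => hbI q

end Groups

/-! ### Cube decomposition and balance of exponents -/

section Cells

/-- Hölder's inequality against the constant `1`, with exponents `1 / θ` and `1 / (1 - θ)`. -/
theorem Finset.sum_rpow_le_rpow_mul_card_rpow {ι : Type*} (s : Finset ι) {f : ι → ℝ}
    (hf : ∀ i ∈ s, 0 ≤ f i) {θ : ℝ} (h0 : 0 < θ) (h1 : θ < 1) :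
    ∑ i ∈ s, f i ^ θ ≤ (∑ i ∈ s, f i) ^ θ * (s.card : ℝ) ^ (1 - θ) := by
  have hpq : Real.HolderConjugate (1 / θ) (1 / (1 - θ)) := by
    rw [Real.holderConjugate_iff]
    refine ⟨by rw [lt_div_iff₀ h0]; linarith, by simp⟩
  have := Real.inner_le_Lp_mul_Lq_of_nonneg s hpq (f := fun i => f i ^ θ) (g := fun _ => 1)
    (fun i hi => Real.rpow_nonneg (hf i hi) _) (fun i _ => zero_le_one)
  simp only [mul_one, one_div_one_div, Real.one_rpow, Finset.sum_const, nsmul_eq_mul] at this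
  refine this.trans (le_of_eq ?_)
  congr 2
  refine Finset.sum_congr rfl fun i hi => ?_
  rw [← Real.rpow_mul (hf i hi), mul_one_div_cancel h0.ne', Real.rpow_one]

theorem card_Icc_floor_le {a : ℝ} (ha : 0 ≤ a) :
    ((⌊a⌋ + 1 - ⌊-a⌋).toNat : ℝ) ≤ 2 * a + 2 := by
  have hmono : ⌊-a⌋ ≤ ⌊a⌋ := Int.floor_mono (by linarith)
  have : (((⌊a⌋ + 1 - ⌊-a⌋).toNat : ℤ) : ℝ) = ⌊a⌋ + 1 - ⌊-a⌋ := by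
    rw [Int.toNat_of_nonneg (by omega)]; push_cast; ring
  rw [Int.cast_natCast] at this
  rw [this]
  have h1 := Int.floor_le a
  have h2 := Int.lt_floor_add_one (-a)
  linarith

/-- Group finitely many points of norm at most `R` into cubes of side `r`, and leave the others
alone. -/
theorem exists_labelling {d N : ℕ} (y : Fin N → EuclideanSpace ℝ (Fin d)) {r R θ : ℝ} (hr : 0 < r)
    (hR : 0 ≤ R) (h0 : 0 < θ) (h1 : θ < 1) :
    ∃ (g : Fin N → (Fin d → ℤ) ⊕ Fin N) (c : (Fin d → ℤ) ⊕ Fin N → EuclideanSpace ℝ (Fin d)),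
      (∀ k, ‖y k - c (g k)‖ ≤ √d * r) ∧
      ∑ q ∈ Finset.univ.image g, ((Finset.univ.filter fun k => g k = q).card : ℝ) ^ θ
        ≤ (N : ℝ) ^ θ * ((2 * R / r + 2) ^ d) ^ (1 - θ)
          + (Finset.univ.filter fun k => R < ‖y k‖).card := by
  classical
  set cell : EuclideanSpace ℝ (Fin d) → Fin d → ℤ := fun x i => ⌊x i / r⌋ with hcell
  -- A far point gets its own label and is its own centre, so its distance to the centre is zero; a
  -- near point is compared with the lower corner of its cube, at distance at most the diagonal `√d
  -- * r`.
  set g : Fin N → (Fin d → ℤ) ⊕ Fin N := fun k =>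
    if ‖y k‖ ≤ R then Sum.inl (cell (y k)) else Sum.inr k with hg
  set c : (Fin d → ℤ) ⊕ Fin N → EuclideanSpace ℝ (Fin d) :=
    Sum.elim (fun v => WithLp.toLp 2 fun i => r * v i) y with hc
  refine ⟨g, c, fun k => ?_, ?_⟩
  · by_cases hk : ‖y k‖ ≤ R
    · have : c (g k) = WithLp.toLp 2 fun i => r * (⌊y k i / r⌋ : ℝ) := by simp [hg, hc, hk, hcell]
      rw [this, EuclideanSpace.norm_eq]
      have hsum : ∑ i, ‖(y k - WithLp.toLp 2 fun i => r * (⌊y k i / r⌋ : ℝ)) i‖ ^ 2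
          ≤ d * r ^ 2 := by
        refine (Finset.sum_le_sum (g := fun _ => r ^ 2) fun i _ => ?_).trans (by simp)
        have e : (y k - WithLp.toLp 2 fun i => r * (⌊y k i / r⌋ : ℝ)) i
            = r * Int.fract (y k i / r) := by
          simp only [PiLp.sub_apply, Int.fract]
          field_simp
        rw [e, norm_mul, Real.norm_of_nonneg hr.le, Real.norm_of_nonneg (Int.fract_nonneg _)]
        have hf1 := (Int.fract_lt_one (y k i / r)).le
        have hf0 := Int.fract_nonneg (y k i / r)
        gcongr
        exact mul_le_of_le_one_right hr.le hf1
      calc √(∑ i, ‖(y k - WithLp.toLp 2 fun i => r * (⌊y k i / r⌋ : ℝ)) i‖ ^ 2)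
          ≤ √(d * r ^ 2) := Real.sqrt_le_sqrt hsum
        _ = √d * r := by rw [Real.sqrt_mul (by positivity), Real.sqrt_sq hr.le]
    · have : c (g k) = y k := by simp [hg, hc, hk]
      rw [this, sub_self, norm_zero]
      positivity
  · set n : (Fin d → ℤ) ⊕ Fin N → ℝ :=
      fun q => ((Finset.univ.filter fun k => g k = q).card : ℝ) with hn
    set box : Finset (Fin d → ℤ) := Fintype.piFinset fun _ => Finset.Icc ⌊-(R / r)⌋ ⌊R / r⌋ with hbox
    set out : Finset (Fin N) := Finset.univ.filter fun k => R < ‖y k‖ with hout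
    have hsub : Finset.univ.image g ⊆ box.map Function.Embedding.inl ∪ out.map Function.Embedding.inr := by
      intro q hq
      obtain ⟨k, -, rfl⟩ := Finset.mem_image.1 hq
      by_cases hk : ‖y k‖ ≤ R
      · refine Finset.mem_union_left _ (Finset.mem_map.2 ⟨cell (y k), ?_, by simp [hg, hk]⟩)
        refine Fintype.mem_piFinset.2 fun i => Finset.mem_Icc.2 ?_
        have hi : |y k i| ≤ R := by
          rw [← Real.norm_eq_abs]
          exact (PiLp.norm_apply_le (y k) i).trans hk
        have := abs_le.1 hi
        constructor
        · refine Int.floor_mono ?_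
          rw [← neg_div]; gcongr; exact this.1
        · refine Int.floor_mono ?_
          gcongr; exact this.2
      · refine Finset.mem_union_right _ (Finset.mem_map.2 ⟨k, ?_, by simp [hg, hk]⟩)
        exact Finset.mem_filter.2 ⟨Finset.mem_univ _, not_le.1 hk⟩
    have hdisj : Disjoint (box.map Function.Embedding.inl) (out.map (Function.Embedding.inr (α := Fin d → ℤ))) := by
      rw [Finset.disjoint_left]
      intro q h1 h2
      obtain ⟨v, -, rfl⟩ := Finset.mem_map.1 h1
      obtain ⟨k, -, hk⟩ := Finset.mem_map.1 h2
      simp at hk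
    have hn0 : ∀ q, 0 ≤ n q := fun q => Nat.cast_nonneg _
    calc ∑ q ∈ Finset.univ.image g, n q ^ θ
        ≤ ∑ q ∈ box.map Function.Embedding.inl ∪ out.map Function.Embedding.inr, n q ^ θ :=
          Finset.sum_le_sum_of_subset_of_nonneg hsub fun q _ _ => Real.rpow_nonneg (hn0 q) _
      _ = ∑ v ∈ box, n (Sum.inl v) ^ θ + ∑ k ∈ out, n (Sum.inr k) ^ θ := by
          rw [Finset.sum_union hdisj, Finset.sum_map, Finset.sum_map]; rfl
      _ ≤ _ := add_le_add ?_ ?_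
    · refine (Finset.sum_rpow_le_rpow_mul_card_rpow box (fun v _ => hn0 _) h0 h1).trans ?_
      have hsumN : ∑ v ∈ box, n (Sum.inl v) ≤ N := by
        have h : ∑ v ∈ box, (Finset.univ.filter fun k => g k = Sum.inl v).card ≤ N := by
          rw [← Finset.card_biUnion]
          · exact (Finset.card_le_univ _).trans (by simp)
          · intro v _ w _ hvw
            refine Finset.disjoint_left.2 fun k hk hk' => hvw ?_
            exact Sum.inl_injective ((Finset.mem_filter.1 hk).2.symm.trans (Finset.mem_filter.1 hk').2)
        simp only [hn]
        exact_mod_cast h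
      have hcard : (box.card : ℝ) ≤ (2 * R / r + 2) ^ d := by
        rw [hbox, Fintype.card_piFinset]
        simp only [Finset.prod_const, Finset.card_univ, Fintype.card_fin, Int.card_Icc]
        rw [Nat.cast_pow]
        gcongr
        refine (card_Icc_floor_le (by positivity)).trans (le_of_eq ?_)
        ring
      have hs0 : 0 ≤ ∑ v ∈ box, n (Sum.inl v) := Finset.sum_nonneg fun v _ => hn0 _
      exact mul_le_mul (Real.rpow_le_rpow hs0 hsumN h0.le)
        (Real.rpow_le_rpow (Nat.cast_nonneg _) hcard (sub_nonneg.2 h1.le))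
        (Real.rpow_nonneg (Nat.cast_nonneg _) _) (Real.rpow_nonneg (Nat.cast_nonneg _) _)
    -- A class with an outlier label has at most one element, so each contributes at most `1`.
    · refine (Finset.sum_le_sum (g := fun _ => (1 : ℝ)) fun k _ => ?_).trans
        (by rw [Finset.sum_const, nsmul_eq_mul, mul_one])
      refine Real.rpow_le_one (hn0 _) ?_ h0.le
      have : (Finset.univ.filter fun j => g j = Sum.inr k).card ≤ 1 := by
        refine Finset.card_le_one.2 fun i hi j hj => ?_
        have key : ∀ i, g i = Sum.inr k → i = k := fun i hi => by
          by_cases h : ‖y i‖ ≤ R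
          · simp [hg, h] at hi
          · simpa [hg, h] using hi
        rw [key i (Finset.mem_filter.1 hi).2, key j (Finset.mem_filter.1 hj).2]
      simp only [hn]
      exact_mod_cast this

/-- The scale balance behind the rate `(h / N) ^ (1 / (2 d + 4))`. -/
theorem rate_balance {d : ℕ} {T h N M : ℝ} (hh : 0 < h) (hT : h ≤ T) (hN : 1 ≤ N) (hM : 1 ≤ M) :
    N⁻¹ * (√h * (N ^ (1 - 1 / ((d : ℝ) + 2))
          * ((2 * (M * N ^ (1 / (2 * (d : ℝ) + 4))) / √h + 2) ^ d) ^ (1 / ((d : ℝ) + 2))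
        + N * N ^ (-(1 / (2 * (d : ℝ) + 4)))))
      ≤ ((2 + 2 * √T) * T ^ (1 / (2 * (d : ℝ) + 4)) + T ^ (1 / 2 - 1 / (2 * (d : ℝ) + 4)))
        * M * (h / N) ^ (1 / (2 * (d : ℝ) + 4)) := by
  set β : ℝ := 1 / (2 * (d : ℝ) + 4) with hβ
  have hd : (0 : ℝ) ≤ d := Nat.cast_nonneg d
  have hβ0 : 0 < β := by positivity
  have hβ4 : β ≤ 1 / 4 := one_div_le_one_div_of_le (by norm_num) (by linarith)
  have hb : 1 / ((d : ℝ) + 2) = 2 * β := by rw [hβ]; field_simp; ring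
  -- This is the exponent to which the number of cells per coordinate direction is raised after
  -- Hölder.
  have hdβ : (d : ℝ) * (2 * β) = 1 - 4 * β := by rw [hβ]; field_simp; ring
  have hN0 : 0 < N := by linarith
  have hT0 : 0 < T := hh.trans_le hT
  have hM0 : 0 < M := by linarith
  have hs : 0 < √h := Real.sqrt_pos.2 hh
  have hsT : √h ≤ √T := Real.sqrt_le_sqrt hT
  have hNβ : 1 ≤ N ^ β := Real.one_le_rpow hN hβ0.le
  have hR1 : 1 ≤ M * N ^ β := one_le_mul_of_one_le_of_one_le hM hNβ
  set c : ℝ := 2 + 2 * √T with hc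
  have hc1 : 1 ≤ c := by have := Real.sqrt_nonneg T; linarith
  have hhN : (h / N) ^ β = h ^ β * N ^ (-β) := by
    rw [Real.div_rpow hh.le hN0.le, Real.rpow_neg hN0.le, div_eq_mul_inv]
  have hcells : ((2 * (M * N ^ β) / √h + 2) ^ d) ^ (1 / ((d : ℝ) + 2))
      ≤ c * M * N ^ β * (√h) ^ (-(1 - 4 * β)) := by
    have h1 : 2 * (M * N ^ β) / √h + 2 ≤ c * (M * N ^ β) / √h := by
      have h2 : 2 * √h ≤ 2 * √T * (M * N ^ β) := by
        calc 2 * √h = 2 * √h * 1 := by ring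
          _ ≤ 2 * √T * (M * N ^ β) := by gcongr
      rw [div_add' _ _ _ hs.ne']
      gcongr
      rw [hc, add_mul]
      linarith
    calc ((2 * (M * N ^ β) / √h + 2) ^ d) ^ (1 / ((d : ℝ) + 2))
        ≤ ((c * (M * N ^ β) / √h) ^ d) ^ (1 / ((d : ℝ) + 2)) := by gcongr
      _ = (c * (M * N ^ β) / √h) ^ (1 - 4 * β) := by
          rw [hb, ← Real.rpow_natCast, ← Real.rpow_mul (by positivity), hdβ]
      _ = (c * (M * N ^ β)) ^ (1 - 4 * β) * (√h) ^ (-(1 - 4 * β)) := by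
          rw [Real.div_rpow (by positivity) hs.le, Real.rpow_neg hs.le, div_eq_mul_inv]
      -- The base is at least `1`, so the exponent may be raised to `1`; this keeps the final bound
      -- linear in `M`.
      _ ≤ (c * (M * N ^ β)) ^ (1 : ℝ) * (√h) ^ (-(1 - 4 * β)) := by
          gcongr
          · exact one_le_mul_of_one_le_of_one_le hc1 hR1
          · linarith
      _ = _ := by rw [Real.rpow_one]; ring
  have hsh : ∀ p : ℝ, (√h) ^ p = h ^ (p / 2) := fun p => by
    rw [Real.sqrt_eq_rpow, ← Real.rpow_mul hh.le]; congr 1; ring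
  have e1 : N⁻¹ * (√h * (N ^ (1 - 1 / ((d : ℝ) + 2)) * (c * M * N ^ β * (√h) ^ (-(1 - 4 * β)))))
      = c * M * (h ^ β * (h ^ β * N ^ (-β))) := by
    have a1 : N⁻¹ * N ^ (1 - 1 / ((d : ℝ) + 2)) * N ^ β = N ^ (-β) := by
      rw [hb, ← Real.rpow_neg_one, ← Real.rpow_add hN0, ← Real.rpow_add hN0]
      congr 1; ring
    have a2 : √h * (√h) ^ (-(1 - 4 * β)) = h ^ β * h ^ β := by
      nth_rewrite 1 [← Real.rpow_one (√h)]
      rw [← Real.rpow_add hs, hsh, ← Real.rpow_add hh]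
      congr 1; ring
    calc _ = c * M * (√h * (√h) ^ (-(1 - 4 * β)))
          * (N⁻¹ * N ^ (1 - 1 / ((d : ℝ) + 2)) * N ^ β) := by ring
      _ = _ := by rw [a1, a2]; ring
  have e2 : N⁻¹ * (√h * (N * N ^ (-β))) = h ^ (1 / 2 - β) * (h ^ β * N ^ (-β)) := by
    have a2 : √h = h ^ (1 / 2 - β) * h ^ β := by
      rw [← Real.rpow_add hh, Real.sqrt_eq_rpow]; congr 1; ring
    calc _ = (N⁻¹ * N) * √h * N ^ (-β) := by ring
      _ = _ := by rw [inv_mul_cancel₀ hN0.ne', a2]; ring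
  calc _ ≤ N⁻¹ * (√h * (N ^ (1 - 1 / ((d : ℝ) + 2)) * (c * M * N ^ β * (√h) ^ (-(1 - 4 * β)))
        + N * N ^ (-β))) := by gcongr
    _ = c * M * (h ^ β * (h ^ β * N ^ (-β))) + h ^ (1 / 2 - β) * (h ^ β * N ^ (-β)) := by
        rw [← e1, ← e2]; ring
    _ ≤ c * M * (T ^ β * (h ^ β * N ^ (-β))) + T ^ (1 / 2 - β) * M * (h ^ β * N ^ (-β)) := by
        gcongr
        refine le_trans ?_ (le_mul_of_one_le_right (by positivity) hM)
        exact Real.rpow_le_rpow hh.le hT (by linarith)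
    _ = _ := by rw [hhN]; ring

/-- Chebyshev's inequality for finitely many points. -/
theorem card_filter_lt_norm_le {d N : ℕ} (y : Fin N → EuclideanSpace ℝ (Fin d)) {M s : ℝ}
    (hM : 0 < M) (hs : 1 ≤ s) (hy : ∑ k, ‖y k‖ ^ 2 ≤ N * M ^ 2) :
    ((Finset.univ.filter fun k => M * s < ‖y k‖).card : ℝ) ≤ N * s⁻¹ := by
  have hs0 : 0 < s := by linarith
  have h1 : ((Finset.univ.filter fun k => M * s < ‖y k‖).card : ℝ) * (M * s) ^ 2 ≤ N * M ^ 2 := by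
    calc _ = ∑ k ∈ Finset.univ.filter fun k => M * s < ‖y k‖, (M * s) ^ 2 := by simp
      _ ≤ ∑ k ∈ Finset.univ.filter fun k => M * s < ‖y k‖, ‖y k‖ ^ 2 :=
          Finset.sum_le_sum fun k hk => by
            have := (Finset.mem_filter.1 hk).2
            gcongr
      _ ≤ ∑ k, ‖y k‖ ^ 2 := Finset.sum_le_univ_sum_of_nonneg fun k => by positivity
      _ ≤ _ := hy
  -- Chebyshev gives decay `s ^ (-2)`; since `1 ≤ s`, it is weakened to the `s⁻¹` that matches the
  -- target rate when `s = N ^ β`.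
  rw [← div_eq_mul_inv, le_div_iff₀ hs0]
  refine le_of_mul_le_mul_right ?_ (by positivity : 0 < M ^ 2)
  refine le_trans ?_ h1
  rw [mul_assoc]
  gcongr
  rw [mul_pow, mul_comm]
  gcongr
  nlinarith

end Cells

/-! ### Assembly of the estimate -/

theorem pMoment_two_empiricalMeasure {d N : ℕ} (hN : 1 ≤ N) (y : Fin N → EuclideanSpace ℝ (Fin d)) :
    pMoment 2 (empiricalMeasure y) = ENNReal.ofReal ((∑ k, ‖y k‖ ^ 2) / N) := by
  have hN0 : (0 : ℝ) < N := by exact_mod_cast hN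
  rw [pMoment, empiricalMeasure, lintegral_smul_measure, lintegral_finsetSum_measure, smul_eq_mul,
    div_eq_inv_mul, ENNReal.ofReal_mul (by positivity), ENNReal.ofReal_inv_of_pos hN0,
    ENNReal.ofReal_natCast, ENNReal.ofReal_sum_of_nonneg fun k _ => by positivity]
  congr 1
  refine Finset.sum_congr rfl fun k _ => ?_
  rw [lintegral_dirac' _ (by fun_prop), ← ofReal_norm, ENNReal.ofReal_rpow_of_nonneg (norm_nonneg _) (by norm_num)]
  norm_num

theorem IsStdBrownianMotion.ae_eq_zero {d : ℕ} {Ω : Type*} [MeasurableSpace Ω] {P : Measure Ω}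
    {B : ℝ≥0 → Ω → EuclideanSpace ℝ (Fin d)} (hB : IsStdBrownianMotion B P) :
    ∀ᵐ ω ∂P, B 0 ω = 0 := by
  have h := ae_all_iff.2 fun i => (hB.coord i).eval_zero_ae_eq_zero
  filter_upwards [h] with ω hω
  ext i
  exact hω i

/-- Bound of the expected transport cost for the Gaussian mixture and a sample of its components. -/
theorem exists_const_lintegral_wassersteinDist_le (d : ℕ) {T : ℝ} (hT : 0 < T) :
    ∃ C : ℝ, 0 < C ∧ ∀ {N : ℕ}, 1 ≤ N → ∀ (y : Fin N → EuclideanSpace ℝ (Fin d))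
      {Ω : Type*} [MeasurableSpace Ω] {P : Measure Ω} [IsProbabilityMeasure P]
      {B : Fin N → ℝ≥0 → Ω → EuclideanSpace ℝ (Fin d)},
      (∀ k, IsStdBrownianMotion (B k) P) →
      iIndepFun (fun (k : Fin N) ω (t : ℝ≥0) => B k t ω) P →
      ∀ (v : EuclideanSpace ℝ (Fin d)) (h : ℝ≥0), 0 < h → (h : ℝ) ≤ T →
        ∫⁻ ω, wassersteinDist 1 ((N : ℝ≥0∞)⁻¹ • ∑ k, P.map fun ω => y k + v + √2 • B k h ω)
            (empiricalMeasure fun k => y k + v + √2 • B k h ω) ∂P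
          ≤ ENNReal.ofReal (C * (1 + √((∑ k, ‖y k‖ ^ 2) / N))
            * ((h : ℝ) / (N : ℝ)) ^ (1 / (2 * (d : ℝ) + 4))) := by
  obtain ⟨C, hC, H⟩ := exists_const_hasCouplingCost_labelled d
  set K : ℝ := (2 + 2 * √T) * T ^ (1 / (2 * (d : ℝ) + 4)) + T ^ (1 / 2 - 1 / (2 * (d : ℝ) + 4))
    with hK
  -- Adding `1` makes the constant strictly positive even if `C` vanishes.
  refine ⟨(C.toReal + 1) * K, by positivity, ?_⟩
  intro N hN y Ω _ P _ B hB hind v h hh hhT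
  have hN1 : (1 : ℝ) ≤ N := by exact_mod_cast hN
  have hN0 : (0 : ℝ) < N := by linarith
  have hh' : (0 : ℝ) < h := hh
  have hr : 0 < √(h : ℝ) := Real.sqrt_pos.2 hh'
  -- The Brownian variables are only a.e. measurable; measurable versions keep their joint
  -- independence and laws.
  set Z : Fin N → Ω → EuclideanSpace ℝ (Fin d) := fun k => ((hB k).aemeasurable h).mk (B k h) with hZ
  have hZm : ∀ k, Measurable (Z k) := fun k => ((hB k).aemeasurable h).measurable_mk
  have hZae : ∀ k, B k h =ᵐ[P] Z k := fun k => ((hB k).aemeasurable h).ae_eq_mk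
  have hZi : iIndepFun Z P :=
    (hind.comp (fun _ w => w h) fun _ => measurable_pi_apply h).congr hZae
  have hZlaw : ∀ k, P.map (Z k) = (stdGaussian (EuclideanSpace ℝ (Fin d))).map (√(h : ℝ) • ·) :=
    fun k => by rw [← Measure.map_congr (hZae k), (hB k).map_eq]
  set M : ℝ := 1 + √((∑ k, ‖y k‖ ^ 2) / N) with hM
  have hM1 : 1 ≤ M := le_add_of_nonneg_right (Real.sqrt_nonneg _)
  have hyM : ∑ k, ‖y k‖ ^ 2 ≤ N * M ^ 2 := by
    have h1 : (∑ k, ‖y k‖ ^ 2) / N ≤ M ^ 2 := by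
      rw [← Real.sqrt_le_left (by linarith)]
      exact le_add_of_nonneg_left zero_le_one
    rwa [div_le_iff₀' hN0] at h1
  set β : ℝ := 1 / (2 * (d : ℝ) + 4) with hβ
  have hβ0 : 0 < β := by positivity
  have hNβ : 1 ≤ (N : ℝ) ^ β := Real.one_le_rpow hN1 hβ0.le
  have hd2 : 1 / ((d : ℝ) + 2) < 1 := by
    rw [div_lt_one (by positivity)]; linarith [(Nat.cast_nonneg d : (0 : ℝ) ≤ d)]
  -- The cube side is the diffusion length `√h`. The radius `M * N ^ β` leaves at most `N * N ^
  -- (-β)` points outside, whose total cost is already of the required order.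
  obtain ⟨g, c, hgc, hsum⟩ := exists_labelling y hr (R := M * (N : ℝ) ^ β)
    (θ := 1 - 1 / ((d : ℝ) + 2)) (by positivity) (by linarith)
    (by have : 0 < 1 / ((d : ℝ) + 2) := by positivity
        linarith)
  obtain ⟨b, hbm, hb, hbI⟩ := H hr hZm hZi hZlaw (fun k => y k + v) g (fun q => c q + v)
    fun k => by rw [add_sub_add_right_eq_sub]; exact hgc k
  have hpt : ∀ᵐ ω ∂P, wassersteinDist 1
      ((N : ℝ≥0∞)⁻¹ • ∑ k, P.map fun ω => y k + v + √2 • B k h ω)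
      (empiricalMeasure fun k => y k + v + √2 • B k h ω) ≤ (N : ℝ≥0∞)⁻¹ * b ω := by
    filter_upwards [ae_all_iff.2 hZae] with ω hω
    have e1 : ∀ k, P.map (fun ω => y k + v + √2 • B k h ω)
        = P.map fun ω => y k + v + √2 • Z k ω := fun k =>
      Measure.map_congr ((hZae k).mono fun ω hω => by simp only [hω])
    have e2 : ∀ k, y k + v + √2 • B k h ω = y k + v + √2 • Z k ω := fun k => by rw [hω k]
    simp only [e1, e2, empiricalMeasure]
    exact ((hb ω).smul _).wassersteinDist_le
  have hreal : (N : ℝ)⁻¹ * (√(h : ℝ) * ∑ q ∈ Finset.univ.image g,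
      ((Finset.univ.filter fun k => g k = q).card : ℝ) ^ (1 - 1 / ((d : ℝ) + 2)))
      ≤ K * M * ((h : ℝ) / N) ^ β := by
    refine le_trans ?_ (rate_balance (d := d) hh' hhT hN1 hM1)
    gcongr
    refine hsum.trans ?_
    have e : 1 - (1 - 1 / ((d : ℝ) + 2)) = 1 / ((d : ℝ) + 2) := by ring
    rw [e]
    gcongr
    refine (card_filter_lt_norm_le y (by linarith) hNβ hyM).trans (le_of_eq ?_)
    rw [Real.rpow_neg hN0.le]
  calc _ ≤ ∫⁻ ω, (N : ℝ≥0∞)⁻¹ * b ω ∂P := lintegral_mono_ae hpt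
    _ = (N : ℝ≥0∞)⁻¹ * ∫⁻ ω, b ω ∂P := lintegral_const_mul _ hbm
    _ ≤ (N : ℝ≥0∞)⁻¹ * (C * ENNReal.ofReal (√(h : ℝ) * ∑ q ∈ Finset.univ.image g,
          ((Finset.univ.filter fun k => g k = q).card : ℝ) ^ (1 - 1 / ((d : ℝ) + 2)))) := by
        gcongr
    _ = C * ENNReal.ofReal ((N : ℝ)⁻¹ * (√(h : ℝ) * ∑ q ∈ Finset.univ.image g,
          ((Finset.univ.filter fun k => g k = q).card : ℝ) ^ (1 - 1 / ((d : ℝ) + 2)))) := by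
        rw [ENNReal.ofReal_mul (inv_nonneg.2 hN0.le), ENNReal.ofReal_inv_of_pos hN0,
          ENNReal.ofReal_natCast]
        ring
    _ ≤ ENNReal.ofReal (C.toReal + 1) * ENNReal.ofReal (K * M * ((h : ℝ) / N) ^ β) := by
        gcongr
        conv_lhs => rw [← ENNReal.ofReal_toReal hC]
        exact ENNReal.ofReal_le_ofReal (by linarith)
    _ = _ := by
        rw [← ENNReal.ofReal_mul (by positivity)]
        congr 1; ring

theorem proposition3p10 (d : ℕ) (T : ℝ) (hT : 0 < T) (a : ℝ) :
    ∃ C : ℝ, 0 < C ∧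
      ∀ (α : EuclideanSpace ℝ (Fin d)), ‖α‖ = a →
      ∀ (N : ℕ), 1 ≤ N →
      ∀ (y : Fin N → EuclideanSpace ℝ (Fin d))
        (Ω : Type*) [MeasurableSpace Ω] (P : Measure Ω) [IsProbabilityMeasure P]
        (B : Fin N → ℝ≥0 → Ω → EuclideanSpace ℝ (Fin d)),
        (∀ k, IsStdBrownianMotion (B k) P) →
        iIndepFun (fun (k : Fin N) ω (t : ℝ≥0) => B k t ω) P →
      ∀ (Y : Fin N → ℝ≥0 → Ω → EuclideanSpace ℝ (Fin d)),
        (∀ k t ω, Y k t ω = y k + (t : ℝ) • α + √2 • B k t ω) →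
      ∀ (m : ℝ → Measure (EuclideanSpace ℝ (Fin d))),
        IsDriftedHeatSolution α T (empiricalMeasure y) m →
      ∀ h : ℝ≥0, (h : ℝ) ≤ T →
        ∫⁻ ω, wassersteinDist 1 (m h) (empiricalMeasure (fun k => Y k h ω)) ∂P
          ≤ ENNReal.ofReal C
            * (1 + pMoment 2 (empiricalMeasure y) ^ (1 / 2 : ℝ))
            * ENNReal.ofReal (((h : ℝ) / (N : ℝ)) ^ (1 / (2 * (d : ℝ) + 4))) := by
  obtain ⟨C, hC, H⟩ := exists_const_lintegral_wassersteinDist_le d hT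
  refine ⟨C, hC, ?_⟩
  intro α _ N hN y Ω _ P _ B hB hind Y hY m hm h hh
  have hN0 : (0 : ℝ) < N := by exact_mod_cast hN
  -- At `h = 0` the cubes would have side `0`; there both measures coincide almost surely, because
  -- the Brownian motions start at the origin.
  rcases eq_or_ne h 0 with rfl | h0
  · have hzero : ∀ᵐ ω ∂P, wassersteinDist 1 (m (0 : ℝ≥0)) (empiricalMeasure fun k => Y k 0 ω) = 0 := by
      filter_upwards [ae_all_iff.2 fun k => (hB k).ae_eq_zero] with ω hω
      have hYy : (fun k => Y k 0 ω) = y := by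
        ext1 k
        rw [hY, hω k]
        simp
      rw [hYy, NNReal.coe_zero, hm.initial]
      exact le_antisymm (HasCouplingCost.refl _).wassersteinDist_le bot_le
    rw [lintegral_congr_ae hzero]
    simp
  · simp_rw [hm.eq_average_map hN hB hh, hY]
    refine (H hN y hB hind ((h : ℝ) • α) h (pos_of_ne_zero h0) hh).trans (le_of_eq ?_)
    have hq : 0 ≤ (∑ k, ‖y k‖ ^ 2) / (N : ℝ) :=
      div_nonneg (Finset.sum_nonneg fun k _ => sq_nonneg _) hN0.le
    have hs := Real.sqrt_nonneg ((∑ k, ‖y k‖ ^ 2) / (N : ℝ))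
    rw [ENNReal.ofReal_mul (mul_nonneg hC.le (add_nonneg zero_le_one hs)),
      ENNReal.ofReal_mul hC.le, pMoment_two_empiricalMeasure hN,
      ENNReal.ofReal_rpow_of_nonneg hq one_half_pos.le, ← Real.sqrt_eq_rpow,
      ENNReal.ofReal_add zero_le_one hs, ENNReal.ofReal_one]
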